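/- **Corollary 3.2.** Let $Q$ be a finite quiver with set of vertices $Q_0$ and set of arrows $Q_1$ (loops and parallel arrows allowed) which is 2-connected, i.e. its underlying graph is (non-empty and) connected and removing any one edge does not disconnect it. Let $b(Q)=\sharp\{\text{connected components}\}-\sharp Q_0+\sharp Q_1$ be its Betti number. For a finite field $\mathbb F_q$ and $\alpha\ge 1$, let $A_{Q,\underline 1,\alpha}(q)$ be the number of isomorphism classes of absolutely indecomposable representations of $Q$ over $\mathcal O_\alpha=\mathbb F_q[t]/(t^\alpha)$ which are locally free of rank vector $\underline 1$ (i.e. the module at each vertex is free of rank $1$). Here a representation $M$ is absolutely indecomposable if $M\otimes_{\mathbb F_q}\overline{\mathbb F_q}$ is non-zero and is not the direct sum of two non-zero subrepresentations. Let $\sharp_{\mathbb F_q}\mu_{Q,\underline 1,\alpha}^{-1}(0)$ be the number of $(x_a,y_a)_{a\in Q_1}\in(\mathcal O_\alpha\times\mathcal O_\alpha)^{Q_1}$ such that $$\sum_{a:\ t(a)=i}x_ay_a-\sum_{a:\ s(a)=i}y_ax_a=0\qquad\text{for all } i\in Q_0,$$ where $s(a)$ and $t(a)$ are the source and target of $a$.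 Then there are rational functions $A_Q,B_{\mu_Q}\in\mathbb Q(T)$ such that, for every finite field $\mathbb F_q$, $q$ is a pole of neither of them, $$A_Q(q)=\lim_{\alpha\to+\infty}q^{-\alpha b(Q)}A_{Q,\underline 1,\alpha}(q),\qquad B_{\mu_Q}(q)=\lim_{\alpha\to+\infty}q^{-\alpha(2\sharp Q_1-\sharp Q_0+1)}\,\sharp_{\mathbb F_q}\mu_{Q,\underline 1,\alpha}^{-1}(0)$$ (in particular both limits exist), and $$\frac{B_{\mu_Q}(q)}{(1-q^{-1})^{\sharp Q_0}}=\frac{A_Q(q)}{1-q^{-1}},$$ both as an identity of numbers for every such $q$ and as an identity of rational functions of $q$. -/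

import Mathlib

open Filter Topology
open scoped TensorProduct

universe u v w

noncomputable section

namespace ToricQuiver

/-! ### Graph theory of quivers

A quiver is Mathlib's `Quiver V`, with set of vertices `V` and set of arrows `Quiver.Total V`
(loops and parallel arrows are allowed). -/

/-- The number of connected components of the graph underlying a quiver. -/
def numComponents (V : Type u) [Quiver.{v} V] : ℕ :=
  Nat.card (Quiver.WeaklyConnectedComponent V)

/-- The Betti number of the graph underlying a (finite) quiver: components minus vertices
plus edges. -/
def betti (V : Type u) [Quiver.{v} V] : ℤ :=
  (numComponents V : ℤ) - (Nat.card V : ℤ) + (Nat.card (Quiver.Total V) : ℤ)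

/-- The underlying graph is connected: there is exactly one connected component
(in particular there is at least one vertex). -/
def IsConnected (V : Type u) [Quiver.{v} V] : Prop :=
  Nonempty V ∧ Subsingleton (Quiver.WeaklyConnectedComponent V)

/-- The quiver obtained by deleting the arrow `a` (same vertices, all the other arrows). -/
def deleteArrow {V : Type u} [Quiver.{v} V] (a : Quiver.Total V) : WideSubquiver V :=
  fun i j => {f | Quiver.Total.mk i j f ≠ a}

/-- The underlying graph is connected, and removing any one edge does not disconnect it. -/
def IsTwoConnected (V : Type u) [Quiver.{v} V] : Prop :=
  IsConnected V ∧ ∀ a : Quiver.Total V, IsConnected (WideSubquiver.toType V (deleteArrow a))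

/-! ### Quiver representations over a commutative ring -/

/-- A representation over `R` of the quiver `V`. -/
structure QRep (R : Type w) [CommRing R] (V : Type u) [Quiver.{v} V] where
  /-- the module at a vertex -/
  obj : V → Type w
  [addCommGroup : ∀ i, AddCommGroup (obj i)]
  [module : ∀ i, Module R (obj i)]
  /-- the linear map along an arrow -/
  map : ∀ {i j : V}, (i ⟶ j) → (obj i →ₗ[R] obj j)

attribute [instance] QRep.addCommGroup QRep.module

namespace QRep

variable {R : Type w} [CommRing R] {V : Type u} [Quiver.{v} V]

/-- Isomorphism of representations. -/
def Iso (M N : QRep R V) : Prop :=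
  ∃ φ : ∀ i, M.obj i ≃ₗ[R] N.obj i,
    ∀ (i j : V) (a : i ⟶ j) (m : M.obj i), φ j (M.map a m) = N.map a (φ i m)

theorem Iso.refl (M : QRep R V) : Iso M M :=
  ⟨fun i => LinearEquiv.refl R (M.obj i), fun _ _ _ _ => rfl⟩

theorem Iso.symm {M N : QRep R V} (h : Iso M N) : Iso N M := by
  obtain ⟨φ, hφ⟩ := h
  refine ⟨fun i => (φ i).symm, fun i j a n => ?_⟩
  rw [LinearEquiv.symm_apply_eq, hφ, LinearEquiv.apply_symm_apply]

theorem Iso.trans {M N P : QRep R V} (h : Iso M N) (h' : Iso N P) : Iso M P := by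
  obtain ⟨φ, hφ⟩ := h
  obtain ⟨ψ, hψ⟩ := h'
  exact ⟨fun i => (φ i).trans (ψ i), fun i j a m => by
    simp only [LinearEquiv.trans_apply, hφ, hψ]⟩

/-- `M` is locally free of (finite) rank vector `r`: every `M i` is free of rank `r i`. -/
def IsLocallyFreeOfRank (M : QRep R V) (r : V → ℕ) : Prop :=
  ∀ i, Module.Free R (M.obj i) ∧ Module.Finite R (M.obj i) ∧ Module.finrank R (M.obj i) = r i

/-- A family of submodules is a subrepresentation if it is preserved by all arrows. -/
def IsSubrep (M : QRep R V) (U : ∀ i, Submodule R (M.obj i)) : Prop :=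
  ∀ (i j : V) (a : i ⟶ j), ∀ m ∈ U i, M.map a m ∈ U j

/-- `M` is nonzero and is not the direct sum of two nonzero subrepresentations. -/
def IsIndecomposable (M : QRep R V) : Prop :=
  (∃ i, Nontrivial (M.obj i)) ∧
    ∀ U W : ∀ i, Submodule R (M.obj i), M.IsSubrep U → M.IsSubrep W →
      (∀ i, IsCompl (U i) (W i)) → (∀ i, U i = ⊥) ∨ (∀ i, W i = ⊥)

/-- Extension of scalars of a representation along `R → S`. -/
def baseChange (S : Type w) [CommRing S] [Algebra R S] (M : QRep R V) : QRep S V where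
  obj i := S ⊗[R] M.obj i
  map a := (M.map a).baseChange S

/-- Let `R` be an algebra over a field `K`. A representation `M` over `R` is absolutely
indecomposable if the representation `M ⊗ K'` over `R ⊗ K'` is indecomposable, where `K'` is an
algebraic closure of `K`; here `M ⊗ K'` is written as the extension of scalars of `M`
along `R → R ⊗ K'`. -/
def IsAbsIndecomposable (K : Type w) [Field K] [Algebra K R] (M : QRep R V) : Prop :=
  (M.baseChange (R ⊗[K] AlgebraicClosure K)).IsIndecomposable

end QRep

/-- The truncated polynomial ring `K[t]/(t^α)`. -/
abbrev TruncPoly (K : Type w) [Field K] (α : ℕ) : Type w :=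
  Polynomial K ⧸ Ideal.span {(Polynomial.X : Polynomial K) ^ α}

section Counts

variable (K : Type w) [Field K] (V : Type u) [Quiver.{v} V] (r : V → ℕ) (α : ℕ)

/-- Isomorphism, on the absolutely indecomposable, locally free representations of rank `r`
over `K[t]/(t^α)`. -/
def absIndecSetoid :
    Setoid {M : QRep (TruncPoly K α) V //
      M.IsLocallyFreeOfRank r ∧ M.IsAbsIndecomposable K} where
  r M N := QRep.Iso M.1 N.1
  iseqv := ⟨fun M => QRep.Iso.refl M.1, fun h => QRep.Iso.symm h,
    fun h h' => QRep.Iso.trans h h'⟩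

/-- The number of isomorphism classes of absolutely indecomposable, locally free
representations of rank `r` over `K[t]/(t^α)`. -/
def countAbsIndec : ℕ :=
  Nat.card (Quotient (absIndecSetoid K V r α))

end Counts

/-! ### The moment map -/

section MomentMap

variable (R : Type w) [CommRing R] (V : Type u) [Quiver.{v} V] (r : V → ℕ)

/-- Representations of the double quiver on the free modules `R ^ (r i)`: each arrow
`a : i ⟶ j` carries a matrix `x a : R ^ (r i) → R ^ (r j)`
and a matrix `y a : R ^ (r j) → R ^ (r i)`. -/
abbrev DoubleRepSpace : Type (max u v w) :=
  (∀ a : Quiver.Total V, Matrix (Fin (r a.right)) (Fin (r a.left)) R) ×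
    (∀ a : Quiver.Total V, Matrix (Fin (r a.left)) (Fin (r a.right)) R)

/-- The moment map: its component at the vertex `i` is
`∑_{t(a) = i} x a * y a - ∑_{s(a) = i} y a * x a`. -/
def momentMap [DecidableEq V] [Fintype (Quiver.Total V)] (p : DoubleRepSpace R V r) (i : V) :
    Matrix (Fin (r i)) (Fin (r i)) R :=
  (∑ a : Quiver.Total V, Pi.single (M := fun j : V => Matrix (Fin (r j)) (Fin (r j)) R)
      a.right (p.1 a * p.2 a) i) -
    ∑ a : Quiver.Total V, Pi.single (M := fun j : V => Matrix (Fin (r j)) (Fin (r j)) R)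
      a.left (p.2 a * p.1 a) i

end MomentMap

/-- The number of `K`-points of the space of jets over the zero fibre of the moment map, i.e. of
zeros of the moment map with coefficients in `K[t]/(t^α)`. -/
def countMomentZero (K : Type w) [Field K] (V : Type u) [Quiver.{v} V]
    [DecidableEq V] [Fintype (Quiver.Total V)] (r : V → ℕ) (α : ℕ) : ℕ :=
  Nat.card {p : DoubleRepSpace (TruncPoly K α) V r //
    ∀ i, momentMap (TruncPoly K α) V r p i = 0}

end ToricQuiver

end

/-! Both counts are weighted sums over the same data: scalars `x` on the arrows, weighted by the
size of the infinitesimal stabilizer, the space of `ξ` with `x a * (ξ (t a) - ξ (s a)) = 0` for all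
`a`.

For the moment map, fix `x`. The map `y ↦ μ(x, y)` is adjoint to the infinitesimal action, for the
perfect pairing given by the coefficient of the top power of `t`. Hence its kernel has `q ^ (α(#E -
#V))` times as many elements as the infinitesimal stabilizer (`card_ker_toricMoment`). For
representations, absolute indecomposability in rank one means that the arrows with `x a ≠ 0` connect
all vertices. Burnside's lemma counts the torus orbits, and for such `x` the stabilizer in the torus
is the fraction `1 - q⁻¹` of the infinitesimal one (`card_orbits_mul`).

It remains to sum the weights according to the set `S` of arrows where `x` vanishes. Adding one
coefficient to `x` multiplies the weight by `q ^ c(E ∖ S)`, `c` being the number of components and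
`S` the new vanishing set. After normalisation this is a sum over decreasing chains of subsets with
weights `q⁻¹ ^ defect S` (`EdgeTwoConnected.stabSum_eq`). Two-connectedness says exactly that the
defect is positive for `S ≠ ∅`, so these terms decay geometrically and only `S = ∅` survives in the
limit. Its limit is rational in `q`. As the whole graph is connected, `S = ∅` occurs in both counts,
so the limits differ only by the elementary factor `(1 - q⁻¹) / (1 - q⁻¹) ^ #V`. -/

namespace ToricQuiver

/-! ### Components of a graph under deletion of edges. -/

section Graph

variable {V E : Type*} (s t : E → V)

/-- Two vertices are related if an edge in `R` goes from the first to the second. -/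
def edgeRel (R : Set E) (i j : V) : Prop := ∃ a ∈ R, s a = i ∧ t a = j

/-- The number of connected components of the graph with edge set `R`. -/
noncomputable def numComp (R : Set E) : ℕ := Nat.card (Quot (edgeRel s t R))

/-- Functions which are constant along the edges in `R` are functions on the set of components. -/
def constOnEdgesEquiv (R : Set E) (K : Type*) :
    {ξ : V → K // ∀ a ∈ R, ξ (t a) = ξ (s a)} ≃ (Quot (edgeRel s t R) → K) where
  toFun ξ := Quot.lift ξ.1 (by rintro _ _ ⟨a, ha, rfl, rfl⟩; exact (ξ.2 a ha).symm)
  invFun f := ⟨fun i => f (Quot.mk _ i), fun a ha =>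
    congrArg f (Quot.sound ⟨a, ha, rfl, rfl⟩).symm⟩
  left_inv ξ := rfl
  right_inv f := by
    funext x
    induction x using Quot.ind
    rfl

instance [Finite V] (R : Set E) : Finite (Quot (edgeRel s t R)) :=
  Finite.of_surjective (Quot.mk _) Quot.mk_surjective

theorem card_constOnEdges [Finite V] (R : Set E) (K : Type*) :
    Nat.card {ξ : V → K // ∀ a ∈ R, ξ (t a) = ξ (s a)} = Nat.card K ^ numComp s t R := by
  rw [Nat.card_congr (constOnEdgesEquiv s t R K), Nat.card_fun, numComp]

/-- Deleting an edge splits at most one component: away from the class of `t a`, the map from new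
components to old ones is injective. -/
theorem numComp_diff_singleton_le [Finite V] (R : Set E) (a : E) :
    numComp s t (R \ {a}) ≤ numComp s t R + 1 := by
  classical
  let Q := Quot (edgeRel s t (R \ {a}))
  let f : Q → Quot (edgeRel s t R) := Quot.map id fun i j ⟨b, hb, h⟩ => ⟨b, hb.1, h⟩
  -- Merging the class of `t a` into that of `s a` makes `p` constant along `a` too, so it descends
  -- to the old components and gives a partial inverse of `f`.
  let p : V → Q := fun i => if (Quot.mk _ i : Q) = Quot.mk _ (t a) then Quot.mk _ (s a)
    else Quot.mk _ i
  let h : Quot (edgeRel s t R) → Q := Quot.lift p (by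
    rintro _ _ ⟨b, hb, rfl, rfl⟩
    by_cases hba : b = a
    · subst hba
      simp only [p, if_true, ite_self]
    · have : (Quot.mk _ (s b) : Q) = Quot.mk _ (t b) := Quot.sound ⟨b, ⟨hb, hba⟩, rfl, rfl⟩
      simp only [p, this])
  have hf : ∀ x : Q, x ≠ Quot.mk _ (t a) → h (f x) = x := by
    intro x
    induction x using Quot.ind with
    | _ i => intro hx; exact if_neg hx
  let k : Q → Option (Quot (edgeRel s t R)) := fun x =>
    if x = Quot.mk _ (t a) then none else some (f x)
  have hk : Function.Injective k := by
    intro x y hxy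
    by_cases hx : x = Quot.mk _ (t a) <;> by_cases hy : y = Quot.mk _ (t a)
    · rw [hx, hy]
    · simp [k, hx, hy] at hxy
    · simp [k, hx, hy] at hxy
    · simp only [k, hx, hy, if_false, Option.some.injEq] at hxy
      rw [← hf x hx, ← hf y hy, hxy]
  calc numComp s t (R \ {a}) ≤ Nat.card (Option (Quot (edgeRel s t R))) :=
        Nat.card_le_card_of_injective k hk
    _ = _ := by rw [Finite.card_option, numComp]

theorem numComp_eq_one_iff [Finite V] [Nonempty V] (R : Set E) :
    numComp s t R = 1 ↔
      ∀ P : V → Prop, (∀ a ∈ R, P (s a) ↔ P (t a)) → ∀ i j, P i → P j := by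
  constructor
  · intro h P hP i j hi
    have := (Nat.card_eq_one_iff_unique.1 h).1
    let f : Quot (edgeRel s t R) → Prop := Quot.lift P (by
      rintro _ _ ⟨a, ha, rfl, rfl⟩; exact propext (hP a ha))
    exact (congrArg f (Subsingleton.elim (Quot.mk _ i) (Quot.mk _ j))).mp hi
  · intro h
    refine Nat.card_eq_one_iff_unique.2 ⟨⟨fun x y => ?_⟩, Nonempty.map (Quot.mk _) ‹_›⟩
    induction x using Quot.ind with | _ i => ?_
    induction y using Quot.ind with | _ j => ?_
    refine (h (fun k => Quot.mk (edgeRel s t R) i = Quot.mk _ k) (fun a ha => ?_) i j rfl)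
    rw [show Quot.mk (edgeRel s t R) (s a) = Quot.mk _ (t a) from
      Quot.sound ⟨a, ha, rfl, rfl⟩]

/-- The graph is connected and remains so after deleting any edge. -/
def EdgeTwoConnected : Prop :=
  numComp s t Set.univ = 1 ∧ ∀ a, numComp s t {a}ᶜ = 1

variable {s t}

/-- The first deletion creates no new component and each further one creates at most one. -/
theorem EdgeTwoConnected.numComp_compl_le [Finite V] (h : EdgeTwoConnected s t)
    (S : Finset E) (hS : S.Nonempty) : numComp s t {a | a ∉ S} ≤ S.card := by
  classical
  induction hS using Finset.Nonempty.cons_induction with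
  | singleton a =>
    rw [Finset.card_singleton, ← h.2 a]
    apply le_of_eq
    congr 1
    ext b
    simp
  | cons a S ha _ ih =>
    rw [Finset.card_cons]
    refine le_trans (le_of_eq ?_) ((numComp_diff_singleton_le s t {b | b ∉ S} a).trans
      (Nat.add_le_add_right ih 1))
    congr 1
    ext b
    simp [and_comm]

/-- The exponent `#S + 1 - c(E ∖ S)`, where `c` is the number of components. -/
noncomputable def defect (s t : E → V) (S : Finset E) : ℕ :=
  S.card + 1 - numComp s t {a | a ∉ S}

theorem EdgeTwoConnected.defect_empty (h : EdgeTwoConnected s t) : defect s t ∅ = 0 := by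
  have := h.1
  simp only [defect, Finset.notMem_empty, not_false_eq_true, Set.ofPred_true, this,
    Finset.card_empty]

/-- The truncated subtraction in `defect` loses nothing. -/
theorem EdgeTwoConnected.defect_add [Finite V] (h : EdgeTwoConnected s t) (S : Finset E) :
    defect s t S + numComp s t {a | a ∉ S} = S.card + 1 := by
  rcases S.eq_empty_or_nonempty with rfl | hS
  · rw [h.defect_empty]
    simpa using h.1
  · have := h.numComp_compl_le S hS
    rw [defect]
    omega

theorem EdgeTwoConnected.defect_pos [Finite V] (h : EdgeTwoConnected s t) (S : Finset E)
    (hS : S ≠ ∅) : 0 < defect s t S := by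
  have := h.numComp_compl_le S (Finset.nonempty_iff_ne_empty.2 hS)
  rw [defect]
  omega

end Graph

/-! ### From weak connectedness of quivers to component counts. -/

section Quivers

open Quiver

variable {V : Type u} [Quiver.{v} V]

theorem iff_of_weaklyConnected (P : V → Prop) (hP : ∀ (i j : V) (_ : i ⟶ j), P i ↔ P j)
    [h : Subsingleton (WeaklyConnectedComponent V)] (i j : V) : P i → P j := by
  have hij : (WeaklyConnectedComponent.mk i) = WeaklyConnectedComponent.mk j :=
    Subsingleton.elim _ _
  obtain ⟨p⟩ := (WeaklyConnectedComponent.eq i j).1 hij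
  intro hi
  induction p with
  | nil => exact hi
  | cons p f ih =>
    rcases f with f | f
    · exact (hP _ _ f).1 (ih (Subsingleton.elim _ _))
    · exact (hP _ _ f).2 (ih (Subsingleton.elim _ _))

theorem IsTwoConnected.edgeTwoConnected [Finite V] (h : IsTwoConnected V) :
    EdgeTwoConnected (E := Total V) Total.left Total.right := by
  have := h.1.1
  refine ⟨(numComp_eq_one_iff _ _ _).2 fun P hP => ?_, fun a =>
    (numComp_eq_one_iff _ _ _).2 fun P hP => ?_⟩
  · have := h.1.2
    exact iff_of_weaklyConnected P fun i j f => hP ⟨i, j, f⟩ trivial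
  · have := (h.2 a).2
    exact iff_of_weaklyConnected (V := WideSubquiver.toType V (deleteArrow a)) P
      fun i j f => hP ⟨i, j, f.1⟩ f.2

theorem IsConnected.betti_eq (h : IsConnected V) :
    betti V = 1 - (Nat.card V : ℤ) + Nat.card (Total V) := by
  have := h.2
  have : Nonempty (WeaklyConnectedComponent V) := h.1.map WeaklyConnectedComponent.mk
  rw [betti, numComponents, Nat.card_unique]
  rfl

end Quivers

/-! ### Rational functions without poles on `(1, ∞)`, which contains every prime power. -/

/-- On `(1, ∞)`, the rational function `r` has no poles and takes the values of `f`. -/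
def Represents (r : RatFunc ℚ) (f : ℝ → ℝ) : Prop :=
  ∀ q : ℝ, 1 < q → r.denom.eval₂ (algebraMap ℚ ℝ) q ≠ 0 ∧ r.eval (algebraMap ℚ ℝ) q = f q

namespace Represents

variable {r p : RatFunc ℚ} {f g : ℝ → ℝ}

theorem const (c : ℚ) : Represents (RatFunc.C c) fun _ => (c : ℝ) := fun q _ => by
  rw [RatFunc.eval_C, RatFunc.denom_C, Polynomial.eval₂_one]
  exact ⟨one_ne_zero, rfl⟩

theorem X : Represents RatFunc.X fun q => q := fun q _ => by simp [RatFunc.eval_X]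

theorem add (hr : Represents r f) (hp : Represents p g) :
    Represents (r + p) fun q => f q + g q := by
  refine fun q hq => ⟨fun h => ?_, ?_⟩
  · have := Polynomial.eval₂_eq_zero_of_dvd_of_eval₂_eq_zero _ q (RatFunc.denom_add_dvd r p) h
    rw [Polynomial.eval₂_mul] at this
    exact mul_ne_zero (hr q hq).1 (hp q hq).1 this
  · rw [RatFunc.eval_add _ _ (hr q hq).1 (hp q hq).1, (hr q hq).2, (hp q hq).2]

theorem mul (hr : Represents r f) (hp : Represents p g) :
    Represents (r * p) fun q => f q * g q := by
  refine fun q hq => ⟨fun h => ?_, ?_⟩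
  · have := Polynomial.eval₂_eq_zero_of_dvd_of_eval₂_eq_zero _ q (RatFunc.denom_mul_dvd r p) h
    rw [Polynomial.eval₂_mul] at this
    exact mul_ne_zero (hr q hq).1 (hp q hq).1 this
  · rw [RatFunc.eval_mul _ _ (hr q hq).1 (hp q hq).1, (hr q hq).2, (hp q hq).2]

theorem ne_zero (hr : Represents r f) (h0 : ∀ q, 1 < q → f q ≠ 0) : r ≠ 0 := by
  rintro rfl
  refine h0 2 one_lt_two ?_
  rw [← (hr 2 one_lt_two).2, RatFunc.eval_zero]

/-- The denominator of `r⁻¹` is associated to the numerator of `r`, so a pole of `r⁻¹` would be a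
zero of `f`. -/
theorem inv (hr : Represents r f) (h0 : ∀ q, 1 < q → f q ≠ 0) :
    Represents r⁻¹ fun q => (f q)⁻¹ := by
  have hr0 := hr.ne_zero h0
  have hden : ∀ q, 1 < q → r⁻¹.denom.eval₂ (algebraMap ℚ ℝ) q ≠ 0 := by
    intro q hq h
    have := Polynomial.eval₂_eq_zero_of_dvd_of_eval₂_eq_zero _ q
      (RatFunc.associated_denom_inv hr0).dvd h
    refine h0 q hq ?_
    rw [← (hr q hq).2, RatFunc.eval, this, zero_div]
  refine fun q hq => ⟨hden q hq, eq_inv_of_mul_eq_one_left ?_⟩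
  rw [← (hr q hq).2, ← RatFunc.eval_mul _ _ (hden q hq) (hr q hq).1, inv_mul_cancel₀ hr0,
    RatFunc.eval_one]

theorem pow (hr : Represents r f) (n : ℕ) : Represents (r ^ n) fun q => f q ^ n := by
  induction n with
  | zero => simpa using const 1
  | succ n ih => simpa only [pow_succ] using ih.mul hr

theorem one_sub_X_inv : Represents (1 - RatFunc.X⁻¹) fun q => 1 - q⁻¹ := by
  have := (const 1).add ((const (-1)).mul (X.inv fun q hq => by positivity))
  simpa [sub_eq_add_neg] using this

end Represents

/-- `f` is given on `(1, ∞)` by a rational function without poles there. -/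
def IsRationalFun (f : ℝ → ℝ) : Prop := ∃ r, Represents r f

namespace IsRationalFun

variable {f g : ℝ → ℝ}

theorem congr (hf : IsRationalFun f) (h : ∀ q, 1 < q → f q = g q) : IsRationalFun g := by
  obtain ⟨r, hr⟩ := hf
  exact ⟨r, fun q hq => ⟨(hr q hq).1, (hr q hq).2.trans (h q hq)⟩⟩

theorem const (c : ℚ) : IsRationalFun fun _ => (c : ℝ) := ⟨_, .const c⟩

theorem id : IsRationalFun fun q => q := ⟨_, .X⟩

theorem add (hf : IsRationalFun f) (hg : IsRationalFun g) : IsRationalFun fun q => f q + g q :=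
  ⟨_, hf.choose_spec.add hg.choose_spec⟩

theorem mul (hf : IsRationalFun f) (hg : IsRationalFun g) : IsRationalFun fun q => f q * g q :=
  ⟨_, hf.choose_spec.mul hg.choose_spec⟩

theorem inv (hf : IsRationalFun f) (h0 : ∀ q, 1 < q → f q ≠ 0) :
    IsRationalFun fun q => (f q)⁻¹ :=
  ⟨_, hf.choose_spec.inv h0⟩

theorem pow (hf : IsRationalFun f) (n : ℕ) : IsRationalFun fun q => f q ^ n :=
  ⟨_, hf.choose_spec.pow n⟩

theorem sum {ι : Type*} (s : Finset ι) {f : ι → ℝ → ℝ} (h : ∀ i ∈ s, IsRationalFun (f i)) :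
    IsRationalFun fun q => ∑ i ∈ s, f i q := by
  classical
  induction s using Finset.induction_on with
  | empty => simpa using const 0
  | insert a s ha ih =>
    simp only [Finset.sum_insert ha]
    exact (h a (s.mem_insert_self a)).add
      (ih fun i hi => h i (Finset.mem_insert_of_mem hi))

end IsRationalFun

/-! ### Weighted chains of subsets: recursion, summability, rationality. -/

section Recursion

/-- Summing the recursion bounds the partial sums of `a`; once convergence is known, the same
identity is a linear equation for the sum. -/
theorem HasSum.of_affine_recursion {a b : ℕ → ℝ} {u B : ℝ} (hu0 : 0 ≤ u) (hu : u < 1)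
    (ha : ∀ n, 0 ≤ a n) (hb : ∀ n, 0 ≤ b n) (hB : HasSum b B)
    (h : ∀ n, a (n + 1) = u * (a n + b n)) : HasSum a ((a 0 + u * B) / (1 - u)) := by
  have hs : Summable a := by
    refine summable_of_sum_range_le (c := (a 0 + u * B) / (1 - u)) ha fun n => ?_
    rw [le_div_iff₀ (by linarith)]
    have h1 : ∑ i ∈ Finset.range (n + 1), a i =
        a 0 + u * (∑ i ∈ Finset.range n, a i + ∑ i ∈ Finset.range n, b i) := by
      rw [Finset.sum_range_succ', ← Finset.sum_add_distrib, Finset.mul_sum, add_comm]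
      simp only [h]
    have h2 : ∑ i ∈ Finset.range n, b i ≤ B := sum_le_hasSum _ (fun i _ => hb i) hB
    have h3 := Finset.sum_range_succ a n
    have h4 := ha n
    have h5 := mul_le_mul_of_nonneg_left h2 hu0
    linarith
  have h1 : ∑' n, a n = a 0 + u * (∑' n, a n + B) := by
    conv_lhs => rw [hs.tsum_eq_zero_add]
    simp only [h, tsum_mul_left]
    rw [hs.tsum_add hB.summable, hB.tsum_eq]
  have h2 : ∑' n, a n = (a 0 + u * B) / (1 - u) := by
    rw [eq_div_iff (by linarith)]
    linarith
  rw [← h2]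
  exact hs.hasSum

variable {E : Type*} [Fintype E] [DecidableEq E]

/-- The weighted number of chains `univ ⊇ S₁ ⊇ ⋯ ⊇ Sₙ = S`, each `Sᵢ` having
weight `T ^ g Sᵢ`. -/
noncomputable def chainSum (g : Finset E → ℕ) (T : ℝ) : ℕ → Finset E → ℝ
  | 0, S => if S = Finset.univ then 1 else 0
  | n + 1, S => T ^ g S * ∑ S' with S ⊆ S', chainSum g T n S'

theorem chainSum_nonneg (g : Finset E → ℕ) {T : ℝ} (hT : 0 ≤ T) (n : ℕ) (S : Finset E) :
    0 ≤ chainSum g T n S := by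
  induction n generalizing S with
  | zero => rw [chainSum]; positivity
  | succ n ih => exact mul_nonneg (pow_nonneg hT _) (Finset.sum_nonneg fun S' _ => ih S')

theorem chainSum_succ (g : Finset E → ℕ) (T : ℝ) (n : ℕ) (S : Finset E) :
    chainSum g T (n + 1) S =
      T ^ g S * (chainSum g T n S + ∑ S' with S ⊂ S', chainSum g T n S') := by
  rw [chainSum]
  congr 1
  rw [← Finset.sum_insert (by simp)]
  refine Finset.sum_congr ?_ fun _ _ => rfl
  ext S'
  simpa only [Finset.mem_filter_univ, Finset.mem_insert, eq_comm] using
    (le_iff_eq_or_lt (a := S) (b := S'))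

theorem isRationalFun_chainSum_zero (g : Finset E → ℕ) (S : Finset E) :
    IsRationalFun fun q => chainSum g q⁻¹ 0 S :=
  (IsRationalFun.const (if S = Finset.univ then 1 else 0)).congr fun q _ => by
    rw [chainSum]; split_ifs <;> simp

/-- Downward induction on `S`: `chainSum_succ` is an affine recursion of ratio `q⁻¹ ^ g S < 1` whose
source involves only strict supersets. -/
theorem exists_hasSum_chainSum {g : Finset E → ℕ} (hg : ∀ S, S ≠ ∅ → 0 < g S) (S : Finset E)
    (hS : S ≠ ∅) : ∃ f : ℝ → ℝ, IsRationalFun f ∧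
      ∀ q, 1 < q → HasSum (fun n => chainSum g q⁻¹ n S) (f q) := by
  induction S using WellFoundedGT.induction with
  | _ S ih =>
  have : ∀ S' : Finset E, ∃ f : ℝ → ℝ, S ⊂ S' → IsRationalFun f ∧
      ∀ q, 1 < q → HasSum (fun n => chainSum g q⁻¹ n S') (f q) := by
    intro S'
    by_cases h : S ⊂ S'
    · obtain ⟨f, hf⟩ := ih S' h (Finset.nonempty_iff_ne_empty.1
        ((Finset.nonempty_iff_ne_empty.2 hS).mono h.1))
      exact ⟨f, fun _ => hf⟩
    · exact ⟨0, fun h' => absurd h' h⟩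
  choose f hf using this
  have hu : ∀ q : ℝ, 1 < q → q⁻¹ ^ g S < 1 := fun q hq =>
    pow_lt_one₀ (by positivity) (inv_lt_one_of_one_lt₀ hq) (hg S hS).ne'
  have hid : IsRationalFun fun q => q⁻¹ := IsRationalFun.id.inv fun q hq => by positivity
  -- The value `(a 0 + u * B) / (1 - u)` with `u = q⁻¹ ^ g S`, spelled with sums, products and
  -- inverses only.
  refine ⟨fun q => (chainSum g q⁻¹ 0 S + q⁻¹ ^ g S * ∑ S' with S ⊂ S', f S' q) *
    (1 + (-1 : ℚ) * q⁻¹ ^ g S)⁻¹, ?_, fun q hq => ?_⟩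
  · refine IsRationalFun.mul (.add ?_ (.mul (hid.pow _) (.sum _ fun S' hS' =>
      (hf S' (by simpa using hS')).1))) (.inv (.add ?_ (.mul (.const _) (hid.pow _)))
        fun q hq => ?_)
    · exact isRationalFun_chainSum_zero g S
    · simpa using IsRationalFun.const 1
    · have := hu q hq
      push_cast
      linarith
  · have h0 : (0 : ℝ) ≤ q⁻¹ := by positivity
    have := HasSum.of_affine_recursion (a := fun n => chainSum g q⁻¹ n S)
      (b := fun n => ∑ S' with S ⊂ S', chainSum g q⁻¹ n S') (B := ∑ S' with S ⊂ S', f S' q)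
      (pow_nonneg h0 _) (hu q hq) (fun n => chainSum_nonneg g h0 n S)
      (fun n => Finset.sum_nonneg fun S' _ => chainSum_nonneg g h0 n S')
      (hasSum_sum fun S' hS' => (hf S' (by simpa using hS')).2 q hq)
      (fun n => chainSum_succ g _ n S)
    convert this using 1
    push_cast
    rw [div_eq_mul_inv, neg_one_mul, ← sub_eq_add_neg]

theorem tendsto_chainSum_zero {g : Finset E → ℕ} (hg : ∀ S, S ≠ ∅ → 0 < g S) (S : Finset E)
    (hS : S ≠ ∅) {q : ℝ} (hq : 1 < q) :
    Tendsto (fun n => chainSum g q⁻¹ n S) atTop (𝓝 0) := by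
  obtain ⟨f, -, hf⟩ := exists_hasSum_chainSum hg S hS
  exact (hf q hq).summable.tendsto_atTop_zero

/-- At `∅` the ratio is `1`, so the sequence is a constant plus the partial sums of the convergent
series attached to nonempty sets. -/
theorem exists_tendsto_chainSum_empty {g : Finset E → ℕ} (hg : ∀ S, S ≠ ∅ → 0 < g S)
    (h0 : g ∅ = 0) : ∃ L : ℝ → ℝ, IsRationalFun L ∧
      ∀ q, 1 < q → Tendsto (fun n => chainSum g q⁻¹ n ∅) atTop (𝓝 (L q)) := by
  have : ∀ S' : Finset E, ∃ f : ℝ → ℝ, ∅ ⊂ S' → IsRationalFun f ∧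
      ∀ q, 1 < q → HasSum (fun n => chainSum g q⁻¹ n S') (f q) := by
    intro S'
    by_cases h : ∅ ⊂ S'
    · obtain ⟨f, hf⟩ := exists_hasSum_chainSum hg S' (by rintro rfl; exact h.2 h.1)
      exact ⟨f, fun _ => hf⟩
    · exact ⟨0, fun h' => absurd h' h⟩
  choose f hf using this
  refine ⟨fun q => chainSum g q⁻¹ 0 ∅ + ∑ S' with ∅ ⊂ S', f S' q, .add ?_ (.sum _ fun S' hS' =>
    (hf S' (by simpa using hS')).1), fun q hq => ?_⟩
  · exact isRationalFun_chainSum_zero g ∅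
  · have key : ∀ n, chainSum g q⁻¹ n ∅ = chainSum g q⁻¹ 0 ∅ +
        ∑ i ∈ Finset.range n, ∑ S' with ∅ ⊂ S', chainSum g q⁻¹ i S' := by
      intro n
      induction n with
      | zero => simp
      | succ n ih => rw [chainSum_succ, h0, Finset.sum_range_succ, ← add_assoc, ← ih]; ring
    rw [funext key]
    exact tendsto_const_nhds.add (hasSum_sum fun S' hS' =>
      (hf S' (by simpa using hS')).2 q hq).tendsto_sum_nat

end Recursion

/-! ### Coefficients in `K[t]/(t^α)`. -/

namespace TruncPoly

open Polynomial

variable (K : Type w) [Field K] (α : ℕ)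

variable {K α} in
theorem mk_eq_zero_iff (p : K[X]) :
    (Ideal.Quotient.mk _ p : TruncPoly K α) = 0 ↔ ∀ j < α, p.coeff j = 0 := by
  rw [Ideal.Quotient.eq_zero_iff_mem, Ideal.mem_span_singleton, X_pow_dvd_iff]

/-- The element with given coefficients. -/
noncomputable def ofCoeffs : (Fin α → K) →ₗ[K] TruncPoly K α where
  toFun f := Ideal.Quotient.mk _ (∑ j : Fin α, monomial j (f j))
  map_add' f g := by simp only [Pi.add_apply, map_add, Finset.sum_add_distrib]
  map_smul' c f := by
    rw [RingHom.id_apply, ← Ideal.Quotient.mkₐ_eq_mk K, ← map_smul, Finset.smul_sum]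
    simp only [Pi.smul_apply, smul_monomial]

theorem coeff_sum_monomial (f : Fin α → K) (j : Fin α) :
    (∑ i : Fin α, monomial (i : ℕ) (f i)).coeff j = f j := by
  rw [finsetSum_coeff, Finset.sum_eq_single j] <;>
    simp +contextual [coeff_monomial, Fin.ext_iff]

theorem ofCoeffs_coeff (p : K[X]) :
    ofCoeffs K α (fun j => p.coeff j) = Ideal.Quotient.mk _ p := by
  rw [← sub_eq_zero, ofCoeffs, LinearMap.coe_mk, AddHom.coe_mk, ← map_sub, mk_eq_zero_iff]
  intro j hj
  rw [coeff_sub, coeff_sum_monomial K α (fun j => p.coeff j) ⟨j, hj⟩, sub_self]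

theorem ofCoeffs_bijective : Function.Bijective (ofCoeffs K α) := by
  constructor
  · rw [injective_iff_map_eq_zero]
    intro f hf
    rw [ofCoeffs, LinearMap.coe_mk, AddHom.coe_mk, mk_eq_zero_iff] at hf
    funext j
    rw [← coeff_sum_monomial K α f j, hf j j.2, Pi.zero_apply]
  · intro x
    obtain ⟨p, rfl⟩ := Ideal.Quotient.mk_surjective x
    exact ⟨_, ofCoeffs_coeff K α p⟩

/-- An element of `K[t]/(t^α)` is determined by its coefficients. -/
noncomputable def coeffs : TruncPoly K α ≃ₗ[K] (Fin α → K) :=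
  (LinearEquiv.ofBijective _ (ofCoeffs_bijective K α)).symm

theorem coeffs_mk (p : K[X]) (j : Fin α) :
    coeffs K α (Ideal.Quotient.mk _ p) j = p.coeff j := by
  rw [← ofCoeffs_coeff]
  exact congrFun ((LinearEquiv.ofBijective _ (ofCoeffs_bijective K α)).symm_apply_apply _) j

/-- Coefficients of tuples. -/
noncomputable def tupleCoeffs (E : Type*) (K : Type w) [Field K] (α : ℕ) : (E → TruncPoly K α) ≃ (E → Fin α → K) :=
  Equiv.piCongrRight fun _ => (coeffs K α).toEquiv

instance [Finite K] : Finite (TruncPoly K α) := Finite.of_equiv _ (coeffs K α).symm.toEquiv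

instance : Module.Finite K (TruncPoly K α) := Module.Finite.equiv (coeffs K α).symm

theorem card : Nat.card (TruncPoly K α) = Nat.card K ^ α := by
  rw [Nat.card_congr (coeffs K α).toEquiv, Nat.card_fun, Nat.card_fin]

variable {K α}

/-- A product vanishes exactly when the orders of vanishing add up to at least `α`. -/
theorem mul_eq_zero_iff (x y : TruncPoly K α) :
    x * y = 0 ↔ ∀ i j : Fin α, (i + j : ℕ) < α → coeffs K α x i ≠ 0 → coeffs K α y j = 0 := by
  obtain ⟨p, rfl⟩ := Ideal.Quotient.mk_surjective x
  obtain ⟨r, rfl⟩ := Ideal.Quotient.mk_surjective y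
  rw [← map_mul, mk_eq_zero_iff]
  simp only [coeffs_mk]
  constructor
  · intro h i j hij hi
    by_contra hj
    have hp : p ≠ 0 := by rintro rfl; simp at hi
    have hr : r ≠ 0 := by rintro rfl; simp at hj
    -- The lowest coefficient of a product is the product of the lowest coefficients, and its degree
    -- is at most `i + j`.
    have := h (p.natTrailingDegree + r.natTrailingDegree) (lt_of_le_of_lt
      (add_le_add (natTrailingDegree_le_of_ne_zero hi) (natTrailingDegree_le_of_ne_zero hj)) hij)
    rw [coeff_mul_natTrailingDegree_add_natTrailingDegree] at this
    exact mul_ne_zero (by simpa using hp) (by simpa using hr) this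
  · intro h n hn
    rw [coeff_mul]
    refine Finset.sum_eq_zero fun ij hij => ?_
    rw [Finset.HasAntidiagonal.mem_antidiagonal] at hij
    by_cases hi : p.coeff ij.1 = 0
    · rw [hi, zero_mul]
    · rw [h ⟨ij.1, by omega⟩ ⟨ij.2, by omega⟩ (by simpa [hij] using hn) hi, mul_zero]

end TruncPoly

/-! ### Infinitesimal stabilizers, and their sum by vanishing set. -/

section Stabilizers

variable {V E : Type*} (s t : E → V) {K : Type w} [Field K] {α : ℕ}

/-- The size of the infinitesimal stabilizer of the representation with coefficients `x`. -/
noncomputable def stabCard (x : E → Fin α → K) : ℕ :=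
  ∏ k : Fin α, Nat.card K ^ numComp s t {a | ∃ j ≤ k, x a j ≠ 0}

/-- The conditions separate by degree: the coefficient of `ξ` in degree `k` must agree at both ends
of `a` as soon as `x a` has a nonzero coefficient in some degree `j` with `j + k < α`, that is `j ≤
k.rev`. -/
theorem card_infinitesimal_stabilizer [Finite V] (x : E → TruncPoly K α) :
    Nat.card {ξ : V → TruncPoly K α // ∀ a, x a * (ξ (t a) - ξ (s a)) = 0} =
      stabCard s t fun a => TruncPoly.coeffs K α (x a) := by
  let R : Fin α → Set E := fun k => {a | ∃ j ≤ k, TruncPoly.coeffs K α (x a) j ≠ 0}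
  let e : (V → TruncPoly K α) ≃ (Fin α → V → K) :=
    (Equiv.piCongrRight fun _ => (TruncPoly.coeffs K α).toEquiv).trans (Equiv.piComm _)
  have he : ∀ ξ : V → TruncPoly K α, (∀ a, x a * (ξ (t a) - ξ (s a)) = 0) ↔
      ∀ k : Fin α, ∀ a ∈ R k.rev, e ξ k (t a) = e ξ k (s a) := by
    intro ξ
    simp only [TruncPoly.mul_eq_zero_iff, map_sub, Pi.sub_apply, sub_eq_zero]
    constructor
    · rintro h k a ⟨j, hj, hne⟩
      exact h a j k (by rw [Fin.le_def, Fin.val_rev] at hj; omega) hne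
    · intro h a i j hij hi
      exact h j a ⟨i, by rw [Fin.le_def, Fin.val_rev]; omega, hi⟩
  rw [Nat.card_congr ((e.subtypeEquiv he).trans (Equiv.subtypePiEquivPi
    (p := fun k (η : V → K) => ∀ a ∈ R k.rev, η (t a) = η (s a)))), Nat.card_pi]
  simp only [card_constOnEdges]
  exact Fintype.prod_equiv Fin.revPerm _ _ fun k => rfl

theorem stabCard_snoc (y : E → Fin α → K) (z : E → K) :
    stabCard s t (fun a => Fin.snoc (α := fun _ => K) (y a) (z a)) =
      stabCard s t y * Nat.card K ^ numComp s t {a | ¬(y a = 0 ∧ z a = 0)} := by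
  rw [stabCard, Fin.prod_univ_castSucc, stabCard]
  congr 1
  · refine Finset.prod_congr rfl fun k _ => ?_
    congr 2
    ext a
    constructor
    · rintro ⟨j, hj, hne⟩
      have hjα : (j : ℕ) < α := lt_of_le_of_lt hj k.2
      refine ⟨j.castLT hjα, hj, ?_⟩
      rwa [← Fin.castSucc_castLT j hjα, Fin.snoc_castSucc] at hne
    · rintro ⟨j, hj, hne⟩
      exact ⟨j.castSucc, hj, by rwa [Fin.snoc_castSucc]⟩
  · congr 2
    ext a
    simp only [Fin.le_last, true_and, Set.mem_ofPred_eq, Fin.exists_fin_succ', Fin.snoc_castSucc,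
      Fin.snoc_last, funext_iff, Pi.zero_apply, not_and_or, not_forall]

variable [Fintype E] [DecidableEq E]

open scoped Classical in
/-- The arrows along which the representation `x` vanishes. -/
noncomputable def zeroArrows {M : Type*} [Zero M] (x : E → M) : Finset E := {a | x a = 0}

variable [Fintype K]

open scoped Classical in
/-- The total size of the infinitesimal stabilizers of the representations vanishing
exactly along the arrows in `S`. -/
noncomputable def stabSum (K : Type w) [Field K] [Fintype K] (α : ℕ) (S : Finset E) : ℕ :=
  ∑ x : E → Fin α → K with zeroArrows x = S, stabCard s t x

open scoped Classical in
theorem card_zeroArrows_inter (S S' : Finset E) (h : S ⊆ S') :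
    ((Finset.univ.filter fun z : E → K => S' ∩ zeroArrows z = S).card : ℝ) =
      ∏ a : E, if a ∈ S then (1 : ℝ) else if a ∈ S' then (Nat.card K : ℝ) - 1 else Nat.card K := by
  have : (Finset.univ.filter fun z : E → K => S' ∩ zeroArrows z = S) =
      Fintype.piFinset fun a : E => if a ∈ S then {0} else
        if a ∈ S' then ({0}ᶜ : Finset K) else Finset.univ := by
    ext z
    simp only [Finset.mem_filter_univ, Fintype.mem_piFinset, Finset.ext_iff, Finset.mem_inter,
      zeroArrows]
    refine forall_congr' fun a => ?_
    have := @h a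
    split_ifs <;> simp_all
  rw [this, Fintype.card_piFinset, Nat.cast_prod]
  refine Finset.prod_congr rfl fun a _ => ?_
  split_ifs
  · simp
  · rw [Finset.card_compl, Finset.card_singleton, Nat.card_eq_fintype_card,
      Nat.cast_sub Fintype.card_pos, Nat.cast_one]
  · simp

theorem prod_ite_eq_pow_compl (S : Finset E) (c : ℝ) :
    ∏ a : E, (if a ∈ S then 1 else c) = c ^ Sᶜ.card := by
  rw [Finset.prod_ite, Finset.prod_const_one, one_mul, Finset.prod_const]
  congr 2
  ext; simp

-- Such a `z` is zero on `S`, nonzero on the rest of `S'` and free elsewhere. In this form the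
-- powers of `1 - q⁻¹` telescope along a chain.
open scoped Classical in
theorem card_zeroArrows_inter_mul (S S' : Finset E) (h : S ⊆ S') :
    ((Finset.univ.filter fun z : E → K => S' ∩ zeroArrows z = S).card : ℝ) *
      (1 - (Nat.card K : ℝ)⁻¹) ^ S'ᶜ.card =
      (Nat.card K : ℝ) ^ Sᶜ.card * (1 - (Nat.card K : ℝ)⁻¹) ^ Sᶜ.card := by
  have hq : (Nat.card K : ℝ) ≠ 0 := Nat.cast_ne_zero.2 Nat.card_pos.ne'
  rw [card_zeroArrows_inter S S' h, ← mul_pow, ← prod_ite_eq_pow_compl, ← prod_ite_eq_pow_compl,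
    ← Finset.prod_mul_distrib]
  refine Finset.prod_congr rfl fun a _ => ?_
  have := @h a
  split_ifs
  · simp
  · exact absurd (this ‹_›) ‹_›
  · field_simp
  · rfl

-- Split `x` into its truncation, vanishing exactly on `S'`, and its top coefficient `z`. By
-- `stabCard_snoc` the extra weight depends only on `S = S' ∩ zeroArrows z`.
open scoped Classical in
theorem stabSum_succ (S : Finset E) :
    stabSum s t K (α + 1) S = Nat.card K ^ numComp s t {a | a ∉ S} *
      ∑ S' with S ⊆ S',
        stabSum s t K α S' * (Finset.univ.filter fun z : E → K => S' ∩ zeroArrows z = S).card := by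
  let e : (E → Fin α → K) × (E → K) ≃ (E → Fin (α + 1) → K) :=
    { toFun := fun p a => Fin.snoc (α := fun _ => K) (p.1 a) (p.2 a)
      invFun := fun x => (fun a => Fin.init (x a), fun a => x a (Fin.last α))
      left_inv := fun p => by simp
      right_inv := fun x => by simp }
  have hz : ∀ p, zeroArrows (e p) = zeroArrows p.1 ∩ zeroArrows p.2 := by
    intro p
    ext a
    simp [zeroArrows, e, funext_iff, Fin.forall_fin_succ']
  have hW : ∀ p, zeroArrows (e p) = S → stabCard s t (e p) =
      Nat.card K ^ numComp s t {a | a ∉ S} * stabCard s t p.1 := by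
    rintro p rfl
    rw [mul_comm, hz]
    refine (stabCard_snoc s t p.1 p.2).trans ?_
    simp [zeroArrows]
  rw [stabSum, Finset.sum_filter, ← e.sum_comp, Fintype.sum_prod_type]
  have : ∀ y : E → Fin α → K,
      (∑ z : E → K, if zeroArrows (e (y, z)) = S then stabCard s t (e (y, z)) else 0) =
      Nat.card K ^ numComp s t {a | a ∉ S} * (stabCard s t y *
        (Finset.univ.filter fun z : E → K => zeroArrows y ∩ zeroArrows z = S).card) := by
    intro y
    rw [← Finset.sum_filter, Finset.sum_congr rfl fun z hz' => hW _ (Finset.mem_filter.1 hz').2,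
      Finset.sum_const (Nat.card K ^ numComp s t {a | a ∉ S} * stabCard s t y), smul_eq_mul]
    simp only [hz]
    ring
  simp only [this]
  rw [← Finset.mul_sum, ← Finset.sum_fiberwise _ (zeroArrows (E := E))]
  congr 1
  rw [Finset.sum_filter]
  refine Finset.sum_congr rfl fun S' _ => ?_
  rw [stabSum, Finset.sum_mul]
  split_ifs with h
  · refine Finset.sum_congr rfl fun y hy => ?_
    rw [(Finset.mem_filter.1 hy).2]
  · refine Finset.sum_eq_zero fun y hy => ?_
    rw [(Finset.mem_filter.1 hy).2, Finset.filter_false_of_mem, Finset.card_empty, mul_zero]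
    rintro z - rfl
    exact h Finset.inter_subset_left

theorem EdgeTwoConnected.stabSum_eq [Finite V] {s t : E → V} (h : EdgeTwoConnected s t)
    (α : ℕ) (S : Finset E) :
    (stabSum s t K α S : ℝ) = (Nat.card K : ℝ) ^ (α * (1 + Fintype.card E)) *
      (1 - (Nat.card K : ℝ)⁻¹) ^ Sᶜ.card * chainSum (defect s t) (Nat.card K : ℝ)⁻¹ α S := by
  have hq : (Nat.card K : ℝ) ≠ 0 := Nat.cast_ne_zero.2 Nat.card_pos.ne'
  induction α generalizing S with
  | zero =>
    classical
    have : ∀ x : E → Fin 0 → K, zeroArrows x = Finset.univ := fun x => by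
      ext a; simp [zeroArrows, Subsingleton.elim (x a) 0]
    rw [stabSum, chainSum]
    simp only [this, stabCard]
    split_ifs with hS
    · subst hS; simp
    · simp [Ne.symm hS]
  | succ α ih =>
    rw [stabSum_succ, chainSum]
    push_cast
    simp only [Finset.mul_sum]
    refine Finset.sum_congr rfl fun S' hS' => ?_
    have h1 := card_zeroArrows_inter_mul (K := K) S S' (Finset.mem_filter.1 hS').2
    -- The definition of the defect gives `c(E ∖ S) + (#E - #S) = 1 + #E - defect S`.
    have h2 : (Nat.card K : ℝ) ^ numComp s t {a | a ∉ S} * (Nat.card K : ℝ) ^ Sᶜ.card =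
        (Nat.card K : ℝ) ^ (1 + Fintype.card E) * ((Nat.card K : ℝ)⁻¹) ^ defect s t S := by
      have := h.defect_add S
      have h3 := S.card_compl
      have h4 := S.card_le_univ
      rw [inv_pow, ← div_eq_mul_inv, eq_div_iff (pow_ne_zero _ hq), ← pow_add, ← pow_add]
      congr 1
      omega
    rw [ih, add_one_mul, pow_add]
    generalize (1 - (Nat.card K : ℝ)⁻¹) = c at *
    linear_combination (Nat.card K : ℝ) ^ numComp s t {a | a ∉ S} *
      (Nat.card K : ℝ) ^ (α * (1 + Fintype.card E)) *
      chainSum (defect s t) (Nat.card K : ℝ)⁻¹ α S' * h1 +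
      (Nat.card K : ℝ) ^ (α * (1 + Fintype.card E)) *
      chainSum (defect s t) (Nat.card K : ℝ)⁻¹ α S' * c ^ Sᶜ.card * h2

end Stabilizers

/-! ### The moment map as adjoint of the infinitesimal action. -/

section Duality

variable {V E : Type*} [Fintype V] [DecidableEq V] [Fintype E] (s t : E → V)

/-- The moment map in rank vector one, as a linear map in the second argument. -/
def toricMoment {R : Type*} [CommRing R] (x : E → R) : (E → R) →ₗ[R] (V → R) where
  toFun y i := (∑ a, if t a = i then x a * y a else 0) - ∑ a, if s a = i then y a * x a else 0
  map_add' y z := by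
    funext i
    simp only [Pi.add_apply, mul_add, add_mul, ← Finset.sum_add_distrib, ← Finset.sum_sub_distrib]
    refine Finset.sum_congr rfl fun a _ => ?_
    split_ifs <;> ring
  map_smul' c y := by
    funext i
    simp only [Pi.smul_apply, smul_eq_mul, RingHom.id_apply, Finset.mul_sum, mul_sub]
    congr 1 <;> refine Finset.sum_congr rfl fun a _ => ?_ <;> split_ifs <;> ring

theorem toricMoment_dotProduct {R : Type*} [CommRing R] (x y : E → R) (ξ : V → R) :
    toricMoment s t x y ⬝ᵥ ξ = y ⬝ᵥ fun a => x a * (ξ (t a) - ξ (s a)) := by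
  simp only [dotProduct, toricMoment, LinearMap.coe_mk, AddHom.coe_mk, sub_mul, Finset.sum_mul,
    Finset.sum_sub_distrib, ite_mul, zero_mul]
  rw [Finset.sum_comm, Finset.sum_comm (f := fun i a => if s a = i then y a * x a * ξ i else 0),
    ← Finset.sum_sub_distrib]
  refine Finset.sum_congr rfl fun a _ => ?_
  simp only [Finset.sum_ite_eq, Finset.mem_univ, if_true]
  ring

variable (K : Type w) [Field K]

/-- The coefficient of the top power of `t`. -/
noncomputable def topCoeff (β : ℕ) : TruncPoly K (β + 1) →ₗ[K] K :=
  LinearMap.proj (Fin.last β) ∘ₗ (TruncPoly.coeffs K (β + 1)).toLinearMap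

-- Multiplication by `t ^ (β - j)` moves the coefficient of degree `j` to the top.
open Polynomial in
variable {K} in
theorem eq_zero_of_topCoeff_mul {β : ℕ} (x : TruncPoly K (β + 1))
    (h : ∀ y, topCoeff K β (y * x) = 0) : x = 0 := by
  obtain ⟨p, rfl⟩ := Ideal.Quotient.mk_surjective x
  rw [TruncPoly.mk_eq_zero_iff]
  intro j hj
  have := h (Ideal.Quotient.mk _ (X ^ (β - j)))
  rw [← map_mul] at this
  have h2 := (TruncPoly.coeffs_mk K (β + 1) (X ^ (β - j) * p) (Fin.last β)).symm.trans this
  rwa [coeff_X_pow_mul', Fin.val_last, if_pos (Nat.sub_le _ _),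
    Nat.sub_sub_self (Nat.lt_succ_iff.1 hj)] at h2

/-- The pairing of tuples through the top coefficient. -/
noncomputable def topPairing (ι : Type*) [Fintype ι] (β : ℕ) :
    LinearMap.BilinForm K (ι → TruncPoly K (β + 1)) :=
  LinearMap.mk₂ K (fun ξ η => topCoeff K β (ξ ⬝ᵥ η))
    (fun _ _ _ => by rw [add_dotProduct, map_add]) (fun _ _ _ => by rw [smul_dotProduct, map_smul])
    (fun _ _ _ => by rw [dotProduct_add, map_add]) (fun _ _ _ => by rw [dotProduct_smul, map_smul])

variable {K}

theorem topPairing_apply {ι : Type*} [Fintype ι] {β : ℕ} (ξ η : ι → TruncPoly K (β + 1)) :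
    topPairing K ι β ξ η = topCoeff K β (ξ ⬝ᵥ η) := rfl

theorem eq_zero_of_topPairing {ι : Type*} [Fintype ι] {β : ℕ} (η : ι → TruncPoly K (β + 1))
    (h : ∀ ξ, topPairing K ι β ξ η = 0) : η = 0 := by
  classical
  funext i
  refine eq_zero_of_topCoeff_mul _ fun y => ?_
  have := h (Pi.single i y)
  rwa [topPairing_apply, single_dotProduct] at this

theorem topPairing_nondegenerate (ι : Type*) [Fintype ι] (β : ℕ) :
    (topPairing K ι β).Nondegenerate := by
  refine ⟨fun ξ h => eq_zero_of_topPairing ξ fun η => ?_, fun η h => eq_zero_of_topPairing η h⟩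
  rw [topPairing_apply, dotProduct_comm]
  exact h η

theorem finrank_tuples (ι : Type*) [Fintype ι] (α : ℕ) :
    Module.finrank K (ι → TruncPoly K α) = Fintype.card ι * α := by
  rw [Module.finrank_pi_fintype]
  simp [(TruncPoly.coeffs K α).finrank_eq]

/-- The orthogonal of the image is the infinitesimal stabilizer; rank–nullity then compares
dimensions over `K`. -/
theorem card_ker_toricMoment [Finite K] (β : ℕ) (x : E → TruncPoly K (β + 1)) :
    Nat.card {y // toricMoment s t x y = 0} * Nat.card K ^ (Fintype.card V * (β + 1)) =
      Nat.card K ^ (Fintype.card E * (β + 1)) *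
        stabCard s t fun a => TruncPoly.coeffs K (β + 1) (x a) := by
  let f : (E → TruncPoly K (β + 1)) →ₗ[K] (V → TruncPoly K (β + 1)) :=
    (toricMoment s t x).restrictScalars K
  have hmem : ∀ ξ, ξ ∈ (topPairing K V β).orthogonal (LinearMap.range f) ↔
      ∀ a, x a * (ξ (t a) - ξ (s a)) = 0 := by
    intro ξ
    rw [LinearMap.BilinForm.mem_orthogonal_iff]
    constructor
    · intro h
      refine congrFun (eq_zero_of_topPairing (fun a => x a * (ξ (t a) - ξ (s a))) fun y => ?_)
      rw [topPairing_apply, ← toricMoment_dotProduct]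
      exact h _ ⟨y, rfl⟩
    · rintro h _ ⟨y, rfl⟩
      change topPairing K V β (toricMoment s t x y) ξ = 0
      rw [topPairing_apply, toricMoment_dotProduct]
      simp only [h]
      rw [show (fun _ : E => (0 : TruncPoly K (β + 1))) = 0 from rfl, dotProduct_zero, map_zero]
  have h1 : Nat.card {y // toricMoment s t x y = 0} =
      Nat.card K ^ Module.finrank K (LinearMap.ker f) := by
    rw [← Module.natCard_eq_pow_finrank (K := K)]
    rfl
  have h2 : (stabCard s t fun a => TruncPoly.coeffs K (β + 1) (x a)) =
      Nat.card K ^ Module.finrank K ((topPairing K V β).orthogonal (LinearMap.range f)) := by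
    rw [← Module.natCard_eq_pow_finrank (K := K), ← card_infinitesimal_stabilizer]
    exact Nat.card_congr (Equiv.subtypeEquivRight fun ξ => (hmem ξ).symm)
  have h3 := LinearMap.BilinForm.finrank_orthogonal (topPairing_nondegenerate (K := K) V β)
    (LinearMap.range f)
  have h4 := f.finrank_range_add_finrank_ker
  have h5 := (LinearMap.range f).finrank_le
  rw [finrank_tuples] at h3 h4 h5
  rw [h1, h2, ← pow_add, ← pow_add]
  congr 1
  omega

end Duality

/-! ### Zeros of the moment map as a sum over `x`. -/

section Count

variable (K : Type w) [Field K] [Fintype K] (V : Type u) [Quiver.{v} V]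
    [DecidableEq V] [Fintype (Quiver.Total V)]

/-- Pairs of scalars on the arrows, as representations of the double quiver. -/
def doubleRepSpaceEquiv (R : Type w) [CommRing R] :
    DoubleRepSpace R V (fun _ => 1) ≃ (Quiver.Total V → R) × (Quiver.Total V → R) :=
  Equiv.prodCongr (Equiv.piCongrRight fun _ => Matrix.uniqueEquiv)
    (Equiv.piCongrRight fun _ => Matrix.uniqueEquiv)

theorem momentMap_eq_zero_iff (R : Type w) [CommRing R]
    (p : DoubleRepSpace R V (fun _ => 1)) :
    (∀ i, momentMap R V (fun _ => 1) p i = 0) ↔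
      toricMoment Quiver.Total.left Quiver.Total.right (doubleRepSpaceEquiv V R p).1
        (doubleRepSpaceEquiv V R p).2 = 0 := by
  have key : ∀ (i j : V) (A : Matrix (Fin 1) (Fin 1) R),
      Pi.single (M := fun _ : V => Matrix (Fin 1) (Fin 1) R) j A i 0 0 =
        if j = i then A 0 0 else 0 := by
    intro i j A
    split_ifs with h
    · subst h; rw [Pi.single_eq_same]
    · rw [Pi.single_eq_of_ne' h]; rfl
  rw [funext_iff]
  refine forall_congr' fun i => ?_
  rw [← (Matrix.uniqueEquiv (m := Fin 1) (n := Fin 1)).injective.eq_iff]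
  change momentMap R V (fun _ => 1) p i 0 0 = 0 ↔ _
  rw [momentMap, Matrix.sub_apply, Matrix.sum_apply, Matrix.sum_apply]
  simp only [key, Matrix.mul_apply, Finset.univ_unique, Finset.sum_singleton]
  rfl

theorem countMomentZero_mul [Fintype V] [DecidableEq (Quiver.Total V)] (β : ℕ) :
    countMomentZero K V (fun _ => 1) (β + 1) * Nat.card K ^ (Fintype.card V * (β + 1)) =
      Nat.card K ^ (Fintype.card (Quiver.Total V) * (β + 1)) *
        ∑ x : Quiver.Total V → Fin (β + 1) → K,
          stabCard Quiver.Total.left Quiver.Total.right x := by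
  classical
  have := Fintype.ofFinite (TruncPoly K (β + 1))
  rw [countMomentZero, Nat.card_congr (((doubleRepSpaceEquiv V (TruncPoly K (β + 1))).subtypeEquiv
    fun p => momentMap_eq_zero_iff V _ p).trans (Equiv.subtypeProdEquivSigmaSubtype
      fun x y => toricMoment Quiver.Total.left Quiver.Total.right x y = 0)), Nat.card_sigma,
    Finset.sum_mul, Finset.mul_sum]
  refine Fintype.sum_equiv (TruncPoly.tupleCoeffs _ K (β + 1)) _ _ fun x => ?_
  exact card_ker_toricMoment _ _ β x

end Count

/-! ### Indecomposability in rank one over a local ring. -/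

section Indecomposable

open Quiver

variable {R : Type w} [CommRing R] {V : Type u} [Quiver.{v} V]

/-- Write `1 = x + y` along the decomposition: in a local ring one of the two is a unit. -/
theorem eq_bot_or_eq_bot_of_isCompl [IsLocalRing R] {N : Type*} [AddCommGroup N] [Module R N]
    (e : N ≃ₗ[R] R) {U W : Submodule R N} (h : IsCompl U W) : U = ⊥ ∨ W = ⊥ := by
  let o := Submodule.orderIsoMapComap e
  have h' : IsCompl (o U) (o W) := o.isCompl h
  have h1 : (1 : R) ∈ o U ⊔ o W := by rw [h'.sup_eq_top]; trivial
  obtain ⟨x, hx, y, hy, hxy⟩ := Submodule.mem_sup.1 h1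
  rcases IsLocalRing.isUnit_or_isUnit_of_add_one hxy with hu | hu
  · right
    have : o U = ⊤ := Ideal.eq_top_of_isUnit_mem (o U) hx hu
    rw [this] at h'
    exact (map_eq_bot_iff o).1 (eq_bot_of_top_isCompl h')
  · left
    have : o W = ⊤ := Ideal.eq_top_of_isUnit_mem (o W) hy hu
    rw [this] at h'
    exact (map_eq_bot_iff o).1 (eq_bot_of_isCompl_top h')

/-- The arrows along which a representation is nonzero. -/
def QRep.support (M : QRep R V) : Set (Total V) := {a | M.map a.hom ≠ 0}

/-- Each vertex module lies entirely in one summand, and a nonzero arrow forces both its ends into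
the same one. Decompositions are thus partitions of the vertices compatible with the support. -/
theorem QRep.isIndecomposable_iff_of_rank_one [IsLocalRing R] [Finite V] [Nonempty V]
    (M : QRep R V) (e : ∀ i, M.obj i ≃ₗ[R] R) :
    M.IsIndecomposable ↔ numComp Total.left Total.right M.support = 1 := by
  classical
  have hnt : ∀ i, Nontrivial (M.obj i) := fun i => (e i).toEquiv.nontrivial
  rw [numComp_eq_one_iff]
  constructor
  · rintro ⟨-, h⟩ P hP i j hi
    by_contra hj
    have hzero : ∀ (i j : V) (a : i ⟶ j), ¬(P i ↔ P j) → M.map a = 0 := by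
      intro i j a hij
      by_contra h0
      exact hij (hP ⟨i, j, a⟩ h0)
    have hU : M.IsSubrep fun i => if P i then ⊤ else ⊥ := by
      intro i j a m hm
      beta_reduce at hm ⊢
      by_cases hij : P i ↔ P j
      · by_cases h : P i
        · rw [if_pos (hij.1 h)]; trivial
        · rw [if_neg h, Submodule.mem_bot] at hm
          rw [hm, map_zero]; exact Submodule.zero_mem _
      · rw [hzero i j a hij]; exact Submodule.zero_mem _
    have hW : M.IsSubrep fun i => if P i then ⊥ else ⊤ := by
      intro i j a m hm
      beta_reduce at hm ⊢
      by_cases hij : P i ↔ P j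
      · by_cases h : P i
        · rw [if_pos h, Submodule.mem_bot] at hm
          rw [hm, map_zero]; exact Submodule.zero_mem _
        · rw [if_neg (fun h' => h (hij.2 h'))]; trivial
      · rw [hzero i j a hij]; exact Submodule.zero_mem _
    have hUW : ∀ i, IsCompl (if P i then (⊤ : Submodule R (M.obj i)) else ⊥) (if P i then ⊥ else ⊤) := by
      intro i
      by_cases h : P i
      · simp only [if_pos h]; exact isCompl_top_bot
      · simp only [if_neg h]; exact isCompl_bot_top
    rcases h _ _ hU hW hUW with h1 | h1
    · have := h1 i
      rw [if_pos hi] at this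
      exact top_ne_bot this
    · have := h1 j
      rw [if_neg hj] at this
      exact top_ne_bot this
  · intro h
    refine ⟨⟨Classical.arbitrary V, hnt _⟩, fun U W hU hW hUW => ?_⟩
    have hor : ∀ i, U i = ⊥ ∨ W i = ⊥ := fun i => eq_bot_or_eq_bot_of_isCompl (e i) (hUW i)
    have hprop : ∀ (U W : ∀ i, Submodule R (M.obj i)), M.IsSubrep W → (∀ i, IsCompl (U i) (W i)) →
        (∀ i, U i = ⊥ ∨ W i = ⊥) → ∀ a ∈ M.support, U a.left = ⊥ → U a.right = ⊥ := by
      intro U W hW hUW hor a ha hl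
      refine (hor a.right).resolve_right fun hr => ha ?_
      have hWt : W a.left = ⊤ := by
        have := hUW a.left
        rw [hl] at this
        exact eq_top_of_bot_isCompl this
      ext m
      have := hW _ _ a.hom m (by rw [hWt]; trivial)
      rwa [hr, Submodule.mem_bot] at this
    have hne : ∀ i, U i = ⊥ ↔ ¬W i = ⊥ := by
      refine fun i => ⟨fun hu hw => ?_, fun hw => (hor i).resolve_right hw⟩
      have := (hUW i).sup_eq_top
      rw [hu, hw, bot_sup_eq] at this
      exact bot_ne_top this
    have hiff : ∀ a ∈ M.support, U a.left = ⊥ ↔ U a.right = ⊥ := by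
      refine fun a ha => ⟨hprop U W hW hUW hor a ha, fun hr => ?_⟩
      rw [hne]
      intro hl
      exact (hne _).1 hr (hprop W U hU (fun i => (hUW i).symm) (fun i => (hor i).symm) a ha hl)
    by_cases hex : ∃ i, U i = ⊥
    · obtain ⟨i, hi⟩ := hex
      exact Or.inl fun j => h (fun i => U i = ⊥) hiff i j hi
    · push Not at hex
      exact Or.inr fun i => (hor i).resolve_left (hex i)

end Indecomposable

/-! ### Units of `K[t]/(t^α)`, and locality after extending scalars. -/

namespace TruncPoly

open Polynomial

variable {K : Type w} [Field K] {β : ℕ}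

theorem isNilpotent_sub (x : TruncPoly K (β + 1)) :
    IsNilpotent (x - algebraMap K _ (coeffs K (β + 1) x 0)) := by
  obtain ⟨p, rfl⟩ := Ideal.Quotient.mk_surjective x
  refine ⟨β + 1, ?_⟩
  rw [coeffs_mk, show algebraMap K (TruncPoly K (β + 1)) (p.coeff ((0 : Fin (β + 1)) : ℕ)) =
    Ideal.Quotient.mk _ (C (p.coeff 0)) from rfl, ← map_sub, ← map_pow,
    Ideal.Quotient.eq_zero_iff_mem, Ideal.mem_span_singleton]
  refine pow_dvd_pow_of_dvd (X_dvd_iff.2 ?_) _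
  simp

instance : Nontrivial (TruncPoly K (β + 1)) := (coeffs K (β + 1)).toEquiv.nontrivial

theorem coeffs_algebraMap_zero (c : K) :
    coeffs K (β + 1) (algebraMap K _ c) 0 = c :=
  (coeffs_mk K (β + 1) (C c) 0).trans (by simp)

theorem isUnit_iff (x : TruncPoly K (β + 1)) : IsUnit x ↔ coeffs K (β + 1) x 0 ≠ 0 := by
  have h := isNilpotent_sub x
  constructor
  · intro hx h0
    rw [h0, map_zero, sub_zero] at h
    exact h.not_isUnit hx
  · intro h0
    have := h.isUnit_add_left_of_commute ((isUnit_iff_ne_zero.2 h0).map (algebraMap K _))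
      (Commute.all _ _)
    rwa [add_sub_cancel] at this

theorem exists_isNilpotent_sub (L : Type w) [Field L] [Algebra K L]
    (x : TruncPoly K (β + 1) ⊗[K] L) : ∃ c : L, IsNilpotent (x - 1 ⊗ₜ c) := by
  induction x with
  | zero => exact ⟨0, by rw [TensorProduct.tmul_zero, sub_zero]; exact ⟨1, pow_one 0⟩⟩
  | tmul o l =>
    refine ⟨coeffs K (β + 1) o 0 • l, ?_⟩
    obtain ⟨n, hn⟩ := isNilpotent_sub o
    have h : o ⊗ₜ[K] l - 1 ⊗ₜ[K] (coeffs K (β + 1) o 0 • l) =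
        (o - algebraMap K _ (coeffs K (β + 1) o 0)) ⊗ₜ[K] l := by
      rw [TensorProduct.sub_tmul, Algebra.algebraMap_eq_smul_one, TensorProduct.smul_tmul]
    by_cases hn0 : n = 0
    · subst hn0
      rw [pow_zero] at hn
      exact absurd hn one_ne_zero
    · exact ⟨n, by rw [h, Algebra.TensorProduct.tmul_pow, hn, TensorProduct.zero_tmul]⟩
  | add x y hx hy =>
    obtain ⟨c, hc⟩ := hx
    obtain ⟨d, hd⟩ := hy
    refine ⟨c + d, ?_⟩
    rw [TensorProduct.tmul_add, add_sub_add_comm]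
    exact (Commute.all (x - 1 ⊗ₜ c) (y - 1 ⊗ₜ d)).isNilpotent_add hc hd

/-- Every element is a scalar of `L` plus a nilpotent, hence a unit unless the scalar is zero. -/
instance isLocalRing_tensorProduct (L : Type w) [Field L] [Algebra K L] :
    IsLocalRing (TruncPoly K (β + 1) ⊗[K] L) := by
  have : Nontrivial (TruncPoly K (β + 1) ⊗[K] L) := inferInstance
  refine IsLocalRing.of_isUnit_or_isUnit_one_sub_self (R := TruncPoly K (β + 1) ⊗[K] L) fun x => ?_
  obtain ⟨c, hc⟩ := exists_isNilpotent_sub L x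
  by_cases h0 : c = 0
  · right
    rw [h0, TensorProduct.tmul_zero, sub_zero] at hc
    exact IsNilpotent.isUnit_one_sub hc
  · left
    have := hc.isUnit_add_left_of_commute ((isUnit_iff_ne_zero.2 h0).map
      (Algebra.TensorProduct.includeRight : L →ₐ[K] TruncPoly K (β + 1) ⊗[K] L))
      (Commute.all (x - 1 ⊗ₜ c) _)
    rwa [Algebra.TensorProduct.includeRight_apply, add_sub_cancel] at this

end TruncPoly

/-! ### Passage to the algebraic closure. -/

section AbsolutelyIndecomposable

open Quiver

variable {K : Type w} [Field K] {β : ℕ} {V : Type u} [Quiver.{v} V]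

theorem QRep.support_baseChange {R S : Type w} [CommRing R] [CommRing S] [Algebra R S]
    [Module.FaithfullyFlat R S] (M : QRep R V) : (M.baseChange S).support = M.support := by
  ext a
  refine not_congr ⟨fun h => ?_, fun h => ?_⟩
  · ext m
    have := LinearMap.congr_fun h ((1 : S) ⊗ₜ[R] m)
    exact (Module.FaithfullyFlat.one_tmul_eq_zero_iff _ _ _).1 this
  · change (M.map a.hom).baseChange S = 0
    rw [h, LinearMap.baseChange_zero]

/-- The extended ring is still local and faithful flatness preserves the support, so the rank one
criterion is insensitive to the extension. -/
theorem QRep.isAbsIndecomposable_iff_of_rank_one [Finite V] [Nonempty V]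
    (M : QRep (TruncPoly K (β + 1)) V) (e : ∀ i, M.obj i ≃ₗ[TruncPoly K (β + 1)] TruncPoly K (β + 1)) :
    M.IsAbsIndecomposable K ↔ numComp Total.left Total.right M.support = 1 := by
  rw [IsAbsIndecomposable, isIndecomposable_iff_of_rank_one, support_baseChange]
  exact fun i => ((e i).baseChange _ _ _ _).trans
    (TensorProduct.AlgebraTensorModule.rid _ _ _)

end AbsolutelyIndecomposable

/-! ### Torus orbits and Burnside's lemma. -/

section Torus

variable {V E : Type*} (s t : E → V) (R : Type*) [CommRing R]

/-- The representations of rank vector one with connected support, as matrix coefficients. -/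
abbrev ConnectedRep : Type _ := {x : E → R // numComp s t {a | x a ≠ 0} = 1}

/-- The action of the torus on representations of rank vector one. -/
instance : MulAction (V → Rˣ) (ConnectedRep s t R) where
  smul g x := ⟨fun a => g (t a) * x.1 a * (g (s a))⁻¹, by
    have h := x.2
    simpa only [ne_eq, Units.mul_left_eq_zero, Units.mul_right_eq_zero] using h⟩
  one_smul x := Subtype.ext (funext fun a => by
    change ((1 : V → Rˣ) (t a) : R) * x.1 a * (((1 : V → Rˣ) (s a))⁻¹ : Rˣ) = x.1 a
    simp)
  mul_smul g h x := Subtype.ext (funext fun a => by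
    change ((g * h) (t a) : R) * x.1 a * (((g * h) (s a))⁻¹ : Rˣ) =
      g (t a) * (h (t a) * x.1 a * ((h (s a))⁻¹ : Rˣ)) * ((g (s a))⁻¹ : Rˣ)
    simp only [Pi.mul_apply, mul_inv_rev, Units.val_mul]
    ring)

variable {s t R}

theorem ConnectedRep.smul_eq_iff (g : V → Rˣ) (x y : ConnectedRep s t R) :
    g • x = y ↔ ∀ a, g (t a) * x.1 a = y.1 a * g (s a) := by
  rw [← Subtype.val_injective.eq_iff, funext_iff]
  refine forall_congr' fun a => ?_
  exact Units.mul_inv_eq_iff_eq_mul (g (s a))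

/-- If an additive map `φ` to a finite field has a section, its nonzero values are
equidistributed. -/
theorem card_ne_zero_mul {A K : Type*} [AddCommGroup A] [AddCommGroup K] [Finite K]
    (φ : A →+ K) (σ : K →+ A) (h : ∀ c, φ (σ c) = c) :
    Nat.card {a // φ a ≠ 0} * Nat.card K = (Nat.card K - 1) * Nat.card A := by
  -- Swap the value `φ a` with the independent scalar, correcting `a` through the section.
  have e : {a // φ a ≠ 0} × K ≃ {c : K // c ≠ 0} × A :=
    { toFun := fun p => (⟨φ p.1, p.1.2⟩, p.1 - σ (φ p.1) + σ p.2)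
      invFun := fun p => (⟨p.2 - σ (φ p.2) + σ p.1, by simpa [h] using p.1.2⟩, φ p.2)
      left_inv := fun p => by ext <;> simp [h]
      right_inv := fun p => by ext <;> simp [h] }
  have h1 : Nat.card {c : K // c ≠ 0} = Nat.card K - 1 := by
    classical
    have := Fintype.ofFinite K
    simp [Fintype.card_subtype_compl]
  rw [← h1, ← Nat.card_prod, ← Nat.card_prod, Nat.card_congr e]

variable {K : Type w} [Field K] {β : ℕ}

/-- The constant coefficient. -/
noncomputable def constCoeff (K : Type w) [Field K] (β : ℕ) : TruncPoly K (β + 1) →ₗ[K] K :=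
  LinearMap.proj 0 ∘ₗ (TruncPoly.coeffs K (β + 1)).toLinearMap

theorem constCoeff_algebraMap (c : K) : constCoeff K β (algebraMap K _ c) = c :=
  TruncPoly.coeffs_algebraMap_zero c

theorem isUnit_iff_constCoeff (x : TruncPoly K (β + 1)) : IsUnit x ↔ constCoeff K β x ≠ 0 :=
  TruncPoly.isUnit_iff x

theorem card_units_mul [Finite K] :
    Nat.card (TruncPoly K (β + 1))ˣ * Nat.card K = (Nat.card K - 1) * Nat.card K ^ (β + 1) := by
  rw [← TruncPoly.card, ← card_ne_zero_mul (constCoeff K β).toAddMonoidHom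
    (algebraMap K (TruncPoly K (β + 1))).toAddMonoidHom constCoeff_algebraMap]
  congr 1
  refine Nat.card_congr ((Equiv.ofBijective (fun u : (TruncPoly K (β + 1))ˣ =>
    (⟨u, (isUnit_iff_constCoeff _).1 u.isUnit⟩ : {a // constCoeff K β a ≠ 0})) ⟨?_, ?_⟩))
  · intro u v h
    exact Units.ext (congrArg Subtype.val h)
  · rintro ⟨a, ha⟩
    obtain ⟨u, rfl⟩ := (isUnit_iff_constCoeff _).2 ha
    exact ⟨u, rfl⟩

/-- Stabilizing `x` is a linear condition on invertible tuples. Connected support makes all constant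
coefficients of a solution equal, so invertibility is tested at one vertex. -/
theorem card_stabilizer_mul [Finite K] [Finite V] [Nonempty V]
    (x : ConnectedRep s t (TruncPoly K (β + 1))) :
    Nat.card (MulAction.stabilizer (V → (TruncPoly K (β + 1))ˣ) x) * Nat.card K =
      (Nat.card K - 1) * stabCard s t (TruncPoly.tupleCoeffs _ K (β + 1) x.1) := by
  let i₀ : V := Classical.arbitrary V
  let A : AddSubgroup (V → TruncPoly K (β + 1)) :=
    { carrier := {ξ | ∀ a, x.1 a * (ξ (t a) - ξ (s a)) = 0}
      zero_mem' := fun a => by simp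
      add_mem' := fun {ξ η} hξ hη a => by
        rw [Pi.add_apply, Pi.add_apply, add_sub_add_comm, mul_add, hξ a, hη a, add_zero]
      neg_mem' := fun {ξ} hξ a => by
        rw [Pi.neg_apply, Pi.neg_apply]; linear_combination -hξ a }
  let φ : A →+ K := ((constCoeff K β).toAddMonoidHom.comp
    (Pi.evalAddMonoidHom _ i₀)).comp A.subtype
  let σ : K →+ A :=
    { toFun := fun c => ⟨fun _ => algebraMap K _ c, fun a => by rw [sub_self, mul_zero]⟩
      map_zero' := by ext; simp
      map_add' := fun c d => by ext; simp }
  have hA : Nat.card A = stabCard s t (TruncPoly.tupleCoeffs _ K (β + 1) x.1) :=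
    card_infinitesimal_stabilizer s t x.1
  have hconst : ∀ ξ ∈ A, ∀ i, constCoeff K β (ξ i) = constCoeff K β (ξ i₀) := by
    intro ξ hξ i
    refine (numComp_eq_one_iff _ _ _).1 x.2
      (fun i => constCoeff K β (ξ i) = constCoeff K β (ξ i₀)) (fun a ha => ?_) i₀ i rfl
    have hex : ∃ k, TruncPoly.coeffs K (β + 1) (x.1 a) k ≠ 0 := by
      by_contra hcon
      push Not at hcon
      exact ha ((TruncPoly.coeffs K (β + 1)).map_eq_zero_iff.1 (funext hcon))
    obtain ⟨k, hk⟩ := hex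
    -- Degree `0` of the difference pairs with any degree `k` in which `x a` is nonzero, since `k +
    -- 0 < β + 1`.
    have h0 : constCoeff K β (ξ (t a) - ξ (s a)) = 0 :=
      (TruncPoly.mul_eq_zero_iff _ _).1 (hξ a) k 0 k.2 hk
    rw [map_sub, sub_eq_zero] at h0
    simp only [h0]
  rw [← hA, ← card_ne_zero_mul φ σ constCoeff_algebraMap]
  congr 1
  have hmem : ∀ g : V → (TruncPoly K (β + 1))ˣ,
      g ∈ MulAction.stabilizer (V → (TruncPoly K (β + 1))ˣ) x ↔
        (fun i => (g i : TruncPoly K (β + 1))) ∈ A := by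
    intro g
    rw [MulAction.mem_stabilizer_iff, ConnectedRep.smul_eq_iff]
    refine forall_congr' fun a => ?_
    rw [mul_sub, sub_eq_zero, mul_comm]
  refine Nat.card_congr (Equiv.ofBijective (fun g => (⟨⟨fun i => (g.1 i : TruncPoly K (β + 1)),
    (hmem g.1).1 g.2⟩, (isUnit_iff_constCoeff _).1 (g.1 i₀).isUnit⟩ : {a : A // φ a ≠ 0}))
    ⟨?_, ?_⟩)
  · intro g h hgh
    refine Subtype.ext (funext fun i => Units.ext ?_)
    exact congrFun (congrArg (fun z : {a : A // φ a ≠ 0} => z.1.1) hgh) i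
  · rintro ⟨⟨ξ, hξ⟩, h0⟩
    have : ∀ i, IsUnit (ξ i) := fun i => (isUnit_iff_constCoeff _).2 (by rwa [hconst ξ hξ i])
    choose g hg using this
    have hgξ : (fun i => (g i : TruncPoly K (β + 1))) = ξ := funext hg
    exact ⟨⟨g, (hmem g).2 (by rwa [hgξ])⟩, Subtype.ext (Subtype.ext hgξ)⟩

-- Burnside's lemma with `#G = ((q - 1) * q ^ β) ^ #V`, after which the representations are grouped
-- by vanishing set.
open scoped Classical in
theorem card_orbits_mul [Fintype K] [Fintype V] [Nonempty V] [Fintype E] [DecidableEq E] :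
    Nat.card (MulAction.orbitRel.Quotient (V → (TruncPoly K (β + 1))ˣ)
      (ConnectedRep s t (TruncPoly K (β + 1)))) *
        ((Nat.card K - 1) * Nat.card K ^ β) ^ Fintype.card V * Nat.card K =
      (Nat.card K - 1) * ∑ S : Finset E with numComp s t {a | a ∉ S} = 1,
        stabSum s t K (β + 1) S := by
  have := Fintype.ofFinite (ConnectedRep s t (TruncPoly K (β + 1)))
  have hq : 0 < Nat.card K := Nat.card_pos
  have hu : Nat.card (TruncPoly K (β + 1))ˣ = (Nat.card K - 1) * Nat.card K ^ β := by
    have := card_units_mul (K := K) (β := β)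
    exact Nat.eq_of_mul_eq_mul_right hq (this.trans (by ring))
  have hG : Nat.card (V → (TruncPoly K (β + 1))ˣ) =
      ((Nat.card K - 1) * Nat.card K ^ β) ^ Fintype.card V := by
    rw [Nat.card_fun, hu, Nat.card_eq_fintype_card (α := V)]
  have hB : (∑ x : ConnectedRep s t (TruncPoly K (β + 1)),
      Nat.card (MulAction.stabilizer (V → (TruncPoly K (β + 1))ˣ) x)) =
      Nat.card (MulAction.orbitRel.Quotient (V → (TruncPoly K (β + 1))ˣ)
        (ConnectedRep s t (TruncPoly K (β + 1)))) * Nat.card (V → (TruncPoly K (β + 1))ˣ) := by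
    rw [← Nat.card_prod, ← Nat.card_sigma]
    refine Nat.card_congr (Equiv.trans ?_ (MulAction.sigmaFixedByEquivOrbitsProdGroup
      (V → (TruncPoly K (β + 1))ˣ) (ConnectedRep s t (TruncPoly K (β + 1)))))
    exact
      { toFun := fun p => ⟨p.2.1, p.1, p.2.2⟩
        invFun := fun p => ⟨p.2.1, p.1, p.2.2⟩ }
  rw [← hG, ← hB, Finset.sum_mul, Finset.sum_congr rfl fun x _ => card_stabilizer_mul x,
    ← Finset.mul_sum]
  congr 1
  have hz : ∀ x : E → TruncPoly K (β + 1), numComp s t {a | x a ≠ 0} =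
      numComp s t {a | a ∉ zeroArrows (TruncPoly.tupleCoeffs E K (β + 1) x)} := by
    intro x
    congr 1
    ext a
    simp [zeroArrows, TruncPoly.tupleCoeffs]
  have h1 : (∑ x : ConnectedRep s t (TruncPoly K (β + 1)),
      stabCard s t (TruncPoly.tupleCoeffs _ K (β + 1) x.1)) =
      ∑ x : E → Fin (β + 1) → K with numComp s t {a | a ∉ zeroArrows x} = 1, stabCard s t x := by
    rw [← Finset.sum_subtype_eq_sum_filter, Finset.subtype_univ]
    refine Fintype.sum_equiv ((TruncPoly.tupleCoeffs E K (β + 1)).subtypeEquiv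
      fun x => by rw [hz]) _ _ fun x => rfl
  rw [h1, ← Finset.sum_fiberwise_of_maps_to (g := zeroArrows)
    (t := Finset.univ.filter fun S : Finset E => numComp s t {a | a ∉ S} = 1)
    (fun x hx => by simpa using hx)]
  refine Finset.sum_congr rfl fun S hS => ?_
  rw [stabSum]
  refine Finset.sum_congr ?_ fun _ _ => rfl
  ext x
  simp only [Finset.mem_filter, Finset.mem_univ, true_and, and_iff_right_iff_imp]
  rintro rfl
  simpa using hS

end Torus

/-! ### Isomorphism classes as torus orbits. -/

section Classes

open Quiver

variable {V : Type u} [Quiver.{v} V]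

/-- The representation with the free module of rank one at each vertex and given scalars on
the arrows. -/
def scalarRep {R : Type w} [CommRing R] (x : Total V → R) : QRep R V where
  obj _ := R
  map {i j} a := x ⟨i, j, a⟩ • LinearMap.id

theorem support_scalarRep {R : Type w} [CommRing R] (x : Total V → R) :
    (scalarRep x).support = {a | x a ≠ 0} := by
  ext a
  refine not_congr ⟨fun h => ?_, fun h => ?_⟩
  · have : x a * 1 = 0 := LinearMap.congr_fun h (1 : R)
    rwa [mul_one] at this
  · change x a • LinearMap.id = 0
    rw [h, zero_smul]

/-- An `R`-linear automorphism of `R` is multiplication by a unit. -/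
theorem scalarRep_iso_iff {R : Type w} [CommRing R] (x y : Total V → R) :
    QRep.Iso (scalarRep x) (scalarRep y) ↔
      ∃ g : V → Rˣ, ∀ a : Total V, g a.right * x a = y a * g a.left := by
  constructor
  · rintro ⟨φ, hφ⟩
    let φ' : V → (R ≃ₗ[R] R) := φ
    have h1 : ∀ i r, φ' i r = r * φ' i 1 := fun i r => by
      rw [← smul_eq_mul, ← map_smul, smul_eq_mul, mul_one]
    have h2 : ∀ i, (φ' i).symm 1 * φ' i 1 = 1 := fun i => by
      rw [← h1, LinearEquiv.apply_symm_apply]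
    refine ⟨fun i => ⟨φ' i 1, (φ' i).symm 1, by rw [mul_comm, h2], h2 i⟩, fun a => ?_⟩
    have h3 : φ' a.right (x a * 1) = y a * φ' a.left 1 := hφ a.left a.right a.hom (1 : R)
    rw [← h3, mul_one, h1 _ (x a), mul_comm]
  · rintro ⟨g, hg⟩
    refine ⟨fun i => LinearEquiv.smulOfUnit (g i), fun i j a (m : R) => ?_⟩
    have h := hg ⟨i, j, a⟩
    change (g j : R) * (x ⟨i, j, a⟩ * (m : R)) = y ⟨i, j, a⟩ * ((g i : R) * (m : R))
    rw [← mul_assoc, h, mul_assoc]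

theorem exists_scalarRep_iso {R : Type w} [CommRing R] (M : QRep R V)
    (e : ∀ i, M.obj i ≃ₗ[R] R) : ∃ x : Total V → R, QRep.Iso (scalarRep x) M := by
  refine ⟨fun a => e a.right (M.map a.hom ((e a.left).symm 1)), fun i => (e i).symm,
    fun i j a (m : R) => ?_⟩
  change (e j).symm (e j (M.map a ((e i).symm 1)) * m) = M.map a ((e i).symm m)
  rw [LinearEquiv.symm_apply_eq, mul_comm, ← smul_eq_mul, ← map_smul, ← map_smul, ← map_smul,
    smul_eq_mul, mul_one]

theorem QRep.Iso.support_eq {R : Type w} [CommRing R] {M N : QRep R V} (h : QRep.Iso M N) :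
    M.support = N.support := by
  have key : ∀ {M N : QRep R V}, QRep.Iso M N → N.support ⊆ M.support := by
    rintro M N ⟨φ, hφ⟩ a ha h0
    refine ha (LinearMap.ext fun n => ?_)
    have := hφ _ _ a.hom ((φ a.left).symm n)
    rw [LinearEquiv.apply_symm_apply, h0] at this
    rw [← this, LinearMap.zero_apply, LinearMap.zero_apply, map_zero]
  exact (key h.symm).antisymm (key h)

variable {K : Type w} [Field K] {β : ℕ}

theorem QRep.IsLocallyFreeOfRank.nonempty_equiv {R : Type w} [CommRing R] [Nontrivial R]
    {M : QRep R V} (h : M.IsLocallyFreeOfRank fun _ => 1) : Nonempty (∀ i, M.obj i ≃ₗ[R] R) := by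
  refine ⟨fun i => ?_⟩
  have h1 := (h i).1
  have h2 := (h i).2.1
  exact LinearEquiv.ofFinrankEq _ _ ((h i).2.2.trans (Module.finrank_self R).symm)

theorem isLocallyFreeOfRank_scalarRep {R : Type w} [CommRing R] [Nontrivial R]
    (x : Total V → R) : (scalarRep x).IsLocallyFreeOfRank fun _ => 1 := fun _ =>
  ⟨inferInstanceAs (Module.Free R R), inferInstanceAs (Module.Finite R R), Module.finrank_self R⟩

theorem countAbsIndec_eq_card_orbits [Finite V] [Nonempty V] :
    countAbsIndec K V (fun _ => 1) (β + 1) =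
      Nat.card (MulAction.orbitRel.Quotient (V → (TruncPoly K (β + 1))ˣ)
        (ConnectedRep (E := Total V) Total.left Total.right (TruncPoly K (β + 1)))) := by
  let F : ConnectedRep (E := Total V) Total.left Total.right (TruncPoly K (β + 1)) →
      {M : QRep (TruncPoly K (β + 1)) V //
        (M.IsLocallyFreeOfRank fun _ => 1) ∧ M.IsAbsIndecomposable K} := fun x =>
    ⟨scalarRep x.1, isLocallyFreeOfRank_scalarRep x.1,
      ((scalarRep x.1).isAbsIndecomposable_iff_of_rank_one fun _ => LinearEquiv.refl _ _).2
        (by rw [support_scalarRep]; exact x.2)⟩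
  have hF : ∀ x y, MulAction.orbitRel (V → (TruncPoly K (β + 1))ˣ) _ x y ↔
      absIndecSetoid K V (fun _ => 1) (β + 1) (F x) (F y) := by
    intro x y
    rw [Setoid.comm']
    refine Iff.trans ?_ (scalarRep_iso_iff x.1 y.1).symm
    exact exists_congr fun g => ConnectedRep.smul_eq_iff g x y
  symm
  refine Nat.card_eq_of_bijective (Quotient.map F fun x y h => (hF x y).1 h) ⟨?_, ?_⟩
  · intro x y
    induction x using Quotient.inductionOn
    induction y using Quotient.inductionOn
    intro h
    exact Quotient.sound ((hF _ _).2 (Quotient.exact h))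
  · intro M
    induction M using Quotient.inductionOn with | _ M => ?_
    obtain ⟨M, hM, hM'⟩ := M
    obtain ⟨e⟩ := hM.nonempty_equiv
    obtain ⟨x, hx⟩ := exists_scalarRep_iso M e
    rw [M.isAbsIndecomposable_iff_of_rank_one e, ← hx.support_eq, support_scalarRep] at hM'
    exact ⟨Quotient.mk _ ⟨x, hM'⟩, Quotient.sound hx⟩

end Classes

/-! ### Normalised counts as chain sums, and their limits. -/

section Limits

variable {V : Type u} [Quiver.{v} V] [Fintype (Quiver.Total V)] [DecidableEq (Quiver.Total V)]

/-- Duality contributes `q ^ (α(#E - #V))` and the sum of stabilizers `q ^ (α(1 + #E))`. -/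
theorem EdgeTwoConnected.normalized_countMomentZero [Fintype V] [DecidableEq V]
    (hE : EdgeTwoConnected (E := Quiver.Total V) Quiver.Total.left Quiver.Total.right)
    (K : Type w) [Field K] [Fintype K] (β : ℕ) :
    (Nat.card K : ℝ) ^ (-(((β + 1 : ℕ) : ℤ) * (2 * (Fintype.card (Quiver.Total V) : ℤ)
        - (Fintype.card V : ℤ) + 1))) * (countMomentZero K V (fun _ => 1) (β + 1) : ℝ) =
      ∑ S : Finset (Quiver.Total V), (1 - (Nat.card K : ℝ)⁻¹) ^ Sᶜ.card *
        chainSum (defect Quiver.Total.left Quiver.Total.right) (Nat.card K : ℝ)⁻¹ (β + 1) S := by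
  have hq : (Nat.card K : ℝ) ≠ 0 := Nat.cast_ne_zero.2 Nat.card_pos.ne'
  have h := congrArg (Nat.cast : ℕ → ℝ) (countMomentZero_mul K V β)
  rw [← Finset.sum_fiberwise _ (zeroArrows (E := Quiver.Total V))] at h
  push_cast at h
  have h2 : ∀ S : Finset (Quiver.Total V), ∑ x : Quiver.Total V → Fin (β + 1) → K with zeroArrows x = S,
      (stabCard Quiver.Total.left Quiver.Total.right x : ℝ) = _ := fun S =>
    (Nat.cast_sum _ _).symm.trans (hE.stabSum_eq (K := K) (β + 1) S)
  simp only [h2, mul_assoc, ← Finset.mul_sum] at h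
  rw [zpow_neg, inv_mul_eq_iff_eq_mul₀ (zpow_ne_zero _ hq)]
  refine mul_right_cancel₀ (pow_ne_zero (Fintype.card V * (β + 1)) hq) (h.trans ?_)
  rw [← mul_assoc, mul_right_comm _ _ ((Nat.card K : ℝ) ^ (Fintype.card V * (β + 1)))]
  congr 1
  rw [← pow_add, ← zpow_natCast, ← zpow_natCast, ← zpow_add₀ hq]
  congr 1
  push_cast
  ring

-- The order of the torus, `((1 - q⁻¹) * q ^ α) ^ #V`, is divided out; the leading `1 - q⁻¹` comes
-- from the stabilizers.
open scoped Classical in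
theorem EdgeTwoConnected.normalized_countAbsIndec [Fintype V] [Nonempty V]
    (hE : EdgeTwoConnected (E := Quiver.Total V) Quiver.Total.left Quiver.Total.right)
    (K : Type w) [Field K] [Fintype K] (β : ℕ) :
    (Nat.card K : ℝ) ^ (-(((β + 1 : ℕ) : ℤ) * (1 - (Fintype.card V : ℤ)
        + Fintype.card (Quiver.Total V)))) * (countAbsIndec K V (fun _ => 1) (β + 1) : ℝ) =
      (1 - (Nat.card K : ℝ)⁻¹) * ((1 - (Nat.card K : ℝ)⁻¹) ^ Fintype.card V)⁻¹ *
      ∑ S : Finset (Quiver.Total V) with numComp Quiver.Total.left Quiver.Total.right {a : Quiver.Total V | a ∉ S} = 1,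
        (1 - (Nat.card K : ℝ)⁻¹) ^ Sᶜ.card *
        chainSum (defect Quiver.Total.left Quiver.Total.right) (Nat.card K : ℝ)⁻¹ (β + 1) S := by
  have hq : (Nat.card K : ℝ) ≠ 0 := Nat.cast_ne_zero.2 Nat.card_pos.ne'
  have hq1 : 1 < Nat.card K := Finite.one_lt_card
  have hc : 1 - (Nat.card K : ℝ)⁻¹ ≠ 0 := by
    have := inv_lt_one_of_one_lt₀ (Nat.one_lt_cast (α := ℝ).2 hq1)
    linarith
  have h := congrArg (Nat.cast : ℕ → ℝ) (card_orbits_mul (K := K) (β := β)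
    (s := Quiver.Total.left (V := V)) (t := Quiver.Total.right (V := V)))
  rw [← countAbsIndec_eq_card_orbits] at h
  push_cast [Nat.cast_sub hq1.le] at h
  simp only [hE.stabSum_eq, mul_assoc, ← Finset.mul_sum] at h
  have h1 : ((Nat.card K : ℝ) - 1) = Nat.card K * (1 - (Nat.card K : ℝ)⁻¹) := by field_simp
  have h2 : ((Nat.card K : ℝ) - 1) * (Nat.card K : ℝ) ^ β =
      (1 - (Nat.card K : ℝ)⁻¹) * (Nat.card K : ℝ) ^ (β + 1) := by rw [h1]; ring
  rw [h2, h1, mul_pow, ← pow_mul] at h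
  generalize Finset.sum (M := ℝ) _ _ = total at h ⊢
  generalize (1 - (Nat.card K : ℝ)⁻¹) = c at *
  rw [zpow_neg, inv_mul_eq_iff_eq_mul₀ (zpow_ne_zero _ hq)]
  have h3 : (Nat.card K : ℝ) ^ ((β + 1) * (1 + Fintype.card (Quiver.Total V))) =
      (Nat.card K : ℝ) ^ (((β + 1 : ℕ) : ℤ) * (1 - (Fintype.card V : ℤ)
        + Fintype.card (Quiver.Total V))) * (Nat.card K : ℝ) ^ ((β + 1) * Fintype.card V) := by
    rw [← zpow_natCast, ← zpow_natCast, ← zpow_add₀ hq]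
    congr 1
    push_cast
    ring
  rw [h3] at h
  have hcN := pow_ne_zero (Fintype.card V) hc
  have hqN := pow_ne_zero ((β + 1) * Fintype.card V) hq
  refine mul_right_cancel₀ (mul_ne_zero (mul_ne_zero hcN hqN) hq) (Eq.trans ?_ (h.trans ?_))
  · ring
  · field_simp

open scoped Classical in
theorem EdgeTwoConnected.tendsto_sum_chainSum [Finite V]
    (hE : EdgeTwoConnected (E := Quiver.Total V) Quiver.Total.left Quiver.Total.right)
    {q L : ℝ} (hq : 1 < q)
    (hL : Tendsto (fun n => chainSum (defect (E := Quiver.Total V) Quiver.Total.left Quiver.Total.right) q⁻¹ n ∅)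
      atTop (𝓝 L)) (𝒮 : Finset (Finset (Quiver.Total V))) (h𝒮 : ∅ ∈ 𝒮) :
    Tendsto (fun n => ∑ S ∈ 𝒮, (1 - q⁻¹) ^ Sᶜ.card *
        chainSum (defect Quiver.Total.left Quiver.Total.right) q⁻¹ n S) atTop
      (𝓝 ((1 - q⁻¹) ^ Fintype.card (Quiver.Total V) * L)) := by
  have := tendsto_finsetSum (x := atTop) 𝒮 (f := fun S n => (1 - q⁻¹) ^ Sᶜ.card *
      chainSum (defect (E := Quiver.Total V) Quiver.Total.left Quiver.Total.right) q⁻¹ n S)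
    (a := fun S => if S = ∅ then (1 - q⁻¹) ^ Fintype.card (Quiver.Total V) * L else 0) (fun S _ => ?_)
  · rwa [Finset.sum_ite_eq' 𝒮 ∅, if_pos h𝒮] at this
  · split_ifs with hS
    · subst hS
      simpa using hL.const_mul _
    · simpa using (tendsto_chainSum_zero hE.defect_pos S hS hq).const_mul _

theorem div_pow_eq_mul_div {F : Type*} [Field F] {c : F} (hc : c ≠ 0) (n : ℕ) (y : F) :
    y / c ^ n = c * (c ^ n)⁻¹ * y / c := by
  field_simp

end Limits

end ToricQuiver

/-! ### The two limits and the identity. -/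

open ToricQuiver in
theorem corollary3p2 (V : Type u) [Quiver.{v} V] [Fintype V] [DecidableEq V]
    [Fintype (Quiver.Total V)] (hV : ToricQuiver.IsTwoConnected V) :
    ∃ A B : RatFunc ℚ,
      (∀ (K : Type w) [Field K] [Fintype K] (q : ℝ), q = (Fintype.card K : ℝ) →
        -- `q` is a pole neither of `A` nor of `B`
        A.denom.eval₂ (algebraMap ℚ ℝ) q ≠ 0 ∧ B.denom.eval₂ (algebraMap ℚ ℝ) q ≠ 0 ∧
        -- `A(q)` and `B(q)` are the limits of the normalised counts
        Tendsto (fun α : ℕ => q ^ (-((α : ℤ) * ToricQuiver.betti V)) *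
            (ToricQuiver.countAbsIndec K V (fun _ => 1) α : ℝ))
          atTop (𝓝 (A.eval (algebraMap ℚ ℝ) q)) ∧
        Tendsto (fun α : ℕ =>
            q ^ (-((α : ℤ) * (2 * (Fintype.card (Quiver.Total V) : ℤ)
              - (Fintype.card V : ℤ) + 1))) *
            (ToricQuiver.countMomentZero K V (fun _ => 1) α : ℝ))
          atTop (𝓝 (B.eval (algebraMap ℚ ℝ) q)) ∧
        -- the identity between the values at `q`
        B.eval (algebraMap ℚ ℝ) q / (1 - q⁻¹) ^ Fintype.card V =
          A.eval (algebraMap ℚ ℝ) q / (1 - q⁻¹)) ∧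
      -- the identity between rational functions
      B / (1 - RatFunc.X⁻¹) ^ Fintype.card V = A / (1 - RatFunc.X⁻¹) := by
  classical
  have hE := hV.edgeTwoConnected
  have : Nonempty V := hV.1.1
  obtain ⟨L, ⟨r, hr⟩, hL⟩ := exists_tendsto_chainSum_empty hE.defect_pos hE.defect_empty
  have hc : ∀ q : ℝ, 1 < q → 1 - q⁻¹ ≠ 0 := fun q hq => by
    have := inv_lt_one_of_one_lt₀ hq
    linarith
  have hB := (Represents.one_sub_X_inv.pow (Fintype.card (Quiver.Total V))).mul hr
  have hA := (Represents.one_sub_X_inv.mul ((Represents.one_sub_X_inv.pow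
    (Fintype.card V)).inv fun q hq => pow_ne_zero _ (hc q hq))).mul hB
  have hX : (1 - RatFunc.X⁻¹ : RatFunc ℚ) ≠ 0 := Represents.one_sub_X_inv.ne_zero hc
  -- `A` is `B` times the elementary factor, so the identity of rational functions is formal.
  refine ⟨(1 - RatFunc.X⁻¹) * ((1 - RatFunc.X⁻¹) ^ Fintype.card V)⁻¹ *
      ((1 - RatFunc.X⁻¹) ^ Fintype.card (Quiver.Total V) * r),
    (1 - RatFunc.X⁻¹) ^ Fintype.card (Quiver.Total V) * r, fun K _ _ q hqK => ?_,
    div_pow_eq_mul_div hX _ _⟩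
  rw [← Nat.card_eq_fintype_card] at hqK
  have hq : 1 < q := by rw [hqK]; exact_mod_cast Finite.one_lt_card (α := K)
  refine ⟨(hA q hq).1, (hB q hq).1, ?_, ?_, ?_⟩
  -- The shift to `α = β + 1` avoids the zero ring at `α = 0`.
  · rw [(hA q hq).2, ← tendsto_add_atTop_iff_nat 1, hV.1.betti_eq, Nat.card_eq_fintype_card,
      Nat.card_eq_fintype_card]
    subst hqK
    simp only [hE.normalized_countAbsIndec]
    refine Tendsto.const_mul _ ((tendsto_add_atTop_iff_nat 1).2
      (hE.tendsto_sum_chainSum hq (hL _ hq) _ ?_))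
    rw [Finset.mem_filter_univ]
    -- The empty vanishing set is among the summands because the whole graph is connected.
    simpa using hE.1
  · rw [(hB q hq).2, ← tendsto_add_atTop_iff_nat 1]
    subst hqK
    simp only [hE.normalized_countMomentZero]
    exact (tendsto_add_atTop_iff_nat 1).2
      (hE.tendsto_sum_chainSum hq (hL _ hq) _ (Finset.mem_univ _))
  · rw [(hA q hq).2, (hB q hq).2]
    exact div_pow_eq_mul_div (hc q hq) _ _
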